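/- Consider a unit-cost word RAM with words of $w$ bits whose instruction set consists of arithmetic operations (addition, subtraction, multiplication, division, remainder), bitwise boolean operations and shifts; the input is read-only, and space is the number of words of working memory used, not counting the input and the reported output. Let $P$ and $Q$ be strings of lengths $m$ and $n$, $m\le n<2^w$, over an alphabet of size $\sigma\ge 2$, both given in packed representation: each character takes $\lceil\log_2\sigma\rceil$ bits, and every word stores $k\ge 1$ consecutive characters, where $k\lceil\log_2\sigma\rceil\le w$ and $k=\Omega(\log n/\log\sigma)$. Let $\mathrm{occ}$ be the number of positions at which $P$ occurs as a substring of $Q$. There is an algorithm (one program for all $w,\sigma,k,P,Q,t$) that, for every integer parameter $t$ with $2\le t<2^w$, given the packed strings $P$ and $Q$ together with $m$, $n$, $t$, $\lceil\log_2\sigma\rceil$ and $k$, reports every position at which $P$ occurs in $Q$ exactly once, in time $$O\left(\frac{n}{\log_\sigma t}+t+m+\mathrm{occ}\right)$$ and space $O(t+m)$. The constants in these bounds depend only on the constant in $k=\Omega(\log n/\log\sigma)$, that is, on a number $a$ with $\log_\sigma n\le a\,k$. -/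

import Mathlib

/-! A unit-cost word RAM with word length `w` (words are `BitVec w`), packed strings, and the
string matching problem. -/

namespace PackedMatching

/-! ### The word RAM -/

/-- Arithmetic, bitwise boolean and shift operations of the machine. -/
inductive BinOp where
  | add | sub | mul | div | mod
  | and | or | xor
  | shl | shr

/-- Words are unsigned, arithmetic is modulo `2 ^ w`; division rounds down; shifts are logical. -/
def BinOp.eval {w : ℕ} : BinOp → BitVec w → BitVec w → BitVec w
  | .add, x, y => x + y
  | .sub, x, y => x - y
  | .mul, x, y => x * y
  | .div, x, y => x / y
  | .mod, x, y => x % y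
  | .and, x, y => x &&& y
  | .or, x, y => x ||| y
  | .xor, x, y => x ^^^ y
  | .shl, x, y => x <<< y.toNat
  | .shr, x, y => x >>> y.toNat

/-- An operand of an instruction: a register or an immediate constant. -/
inductive Operand where
  | reg (i : ℕ)
  | lit (c : ℕ)

/-- The instructions. `readPat` and `readTxt` fetch one word of the read-only input, `load` and
`store` access the working memory (indirect addressing), `report` emits one word to the write-only
output. -/
inductive Instr where
  | nop
  | move (d : ℕ) (a : Operand)
  | op (o : BinOp) (d : ℕ) (a b : Operand)
  | load (d : ℕ) (addr : Operand)
  | store (addr v : Operand)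
  | readPat (d : ℕ) (idx : Operand)
  | readTxt (d : ℕ) (idx : Operand)
  | report (a : Operand)

/-- Tests that control branches and loops (unsigned comparison of two words). -/
inductive Test where
  | eq (a b : Operand)
  | lt (a b : Operand)

/-- Programs. A program is a finite text that does not depend on the word length or on the input;
in particular it mentions only a constant number of registers. -/
inductive Program where
  | instr (i : Instr)
  | seq (p q : Program)
  | branch (b : Test) (p q : Program)
  | loop (b : Test) (p : Program)

/-- The read-only input: the words of the packed pattern and of the packed text. -/
structure Input (w : ℕ) where
  pat : ℕ → BitVec w
  txt : ℕ → BitVec w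

/-- A machine state: registers, working memory, and the words reported so far. -/
structure State (w : ℕ) where
  regs : ℕ → BitVec w
  mem : BitVec w → BitVec w
  out : List (BitVec w)

def Operand.eval {w : ℕ} (s : State w) : Operand → BitVec w
  | .reg i => s.regs i
  | .lit c => BitVec.ofNat w c

def Test.eval {w : ℕ} (s : State w) : Test → Prop
  | .eq a b => a.eval s = b.eval s
  | .lt a b => (a.eval s).toNat < (b.eval s).toNat

def State.setReg {w : ℕ} (s : State w) (d : ℕ) (v : BitVec w) : State w :=
  { s with regs := Function.update s.regs d v }

/-- The effect of one instruction on a machine whose working memory consists of the `S` words with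
addresses `0, …, S - 1`. An access to any other address of the working memory is an error (`none`):
the computation cannot be continued. -/
def Instr.eval {w : ℕ} (inp : Input w) (S : ℕ) (s : State w) : Instr → Option (State w)
  | .nop => some s
  | .move d a => some (s.setReg d (a.eval s))
  | .op o d a b => some (s.setReg d (o.eval (a.eval s) (b.eval s)))
  | .load d addr =>
      if (addr.eval s).toNat < S then some (s.setReg d (s.mem (addr.eval s))) else none
  | .store addr v =>
      if (addr.eval s).toNat < S then
        some { s with mem := Function.update s.mem (addr.eval s) (v.eval s) }
      else none
  | .readPat d idx => some (s.setReg d (inp.pat (idx.eval s).toNat))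
  | .readTxt d idx => some (s.setReg d (inp.txt (idx.eval s).toNat))
  | .report a => some { s with out := s.out ++ [a.eval s] }

/-- `Exec inp S p s T s'`: on the input `inp`, with `S` words of working memory, the program `p`
started in state `s` halts without error in state `s'` after exactly `T` steps. Every executed
instruction and every evaluated test is one step. -/
inductive Exec {w : ℕ} (inp : Input w) (S : ℕ) : Program → State w → ℕ → State w → Prop
  | instr {i : Instr} {s s' : State w} (h : i.eval inp S s = some s') :
      Exec inp S (.instr i) s 1 s'
  | seq {p q : Program} {s₁ s₂ s₃ : State w} {T₁ T₂ : ℕ}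
      (hp : Exec inp S p s₁ T₁ s₂) (hq : Exec inp S q s₂ T₂ s₃) :
      Exec inp S (.seq p q) s₁ (T₁ + T₂) s₃
  | branchTrue {b : Test} {p q : Program} {s s' : State w} {T : ℕ}
      (hb : b.eval s) (hp : Exec inp S p s T s') :
      Exec inp S (.branch b p q) s (T + 1) s'
  | branchFalse {b : Test} {p q : Program} {s s' : State w} {T : ℕ}
      (hb : ¬ b.eval s) (hq : Exec inp S q s T s') :
      Exec inp S (.branch b p q) s (T + 1) s'
  | loopTrue {b : Test} {p : Program} {s₁ s₂ s₃ : State w} {T₁ T₂ : ℕ}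
      (hb : b.eval s₁) (hp : Exec inp S p s₁ T₁ s₂) (hl : Exec inp S (.loop b p) s₂ T₂ s₃) :
      Exec inp S (.loop b p) s₁ (T₁ + T₂ + 1) s₃
  | loopFalse {b : Test} {p : Program} {s : State w} (hb : ¬ b.eval s) :
      Exec inp S (.loop b p) s 1 s

/-! ### Packed strings -/

/-- The number of bits of a character of an alphabet of size `σ`, that is `⌈log₂ σ⌉`. -/
def charBits (σ : ℕ) : ℕ := Nat.clog 2 σ

/-- The code of the character at position `i` (counted from `0`) of `A`; it is `0` past the end. -/
def charCode {σ : ℕ} (A : List (Fin σ)) (i : ℕ) : ℕ := ((A[i]?).map Fin.val).getD 0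

/-- The word number `x` of the packed representation of `A` with `k` characters per word: the
characters at positions `x * k, …, x * k + k - 1`, the first one in the least significant bits.
Unused bits are `0`, and so are all words past the last of the `⌈|A| / k⌉` words of `A`. -/
def packedWord (w k : ℕ) {σ : ℕ} (A : List (Fin σ)) (x : ℕ) : BitVec w :=
  BitVec.ofNat w (∑ j ∈ Finset.range k, charCode A (x * k + j) * 2 ^ (j * charBits σ))

/-- The input of the packed string matching problem. -/
def packedInput (w k : ℕ) {σ : ℕ} (P Q : List (Fin σ)) : Input w where
  pat := packedWord w k P
  txt := packedWord w k Q

/-- Initially registers `0` to `4` hold `|P|`, `|Q|`, the parameter `t`, the number of bits per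
character and the number of characters per word, all other registers are `0`, nothing has been
reported, and the content `mem` of the working memory is arbitrary. -/
def initState (w k t : ℕ) {σ : ℕ} (P Q : List (Fin σ)) (mem : BitVec w → BitVec w) : State w where
  regs
    | 0 => BitVec.ofNat w P.length
    | 1 => BitVec.ofNat w Q.length
    | 2 => BitVec.ofNat w t
    | 3 => BitVec.ofNat w (charBits σ)
    | 4 => BitVec.ofNat w k
    | _ => 0
  mem := mem
  out := []

/-! ### String matching -/

/-- The set of (starting) positions, counted from `0`, of the substrings of `Q` matching `P`. -/
def occurrences {σ : ℕ} (P Q : List (Fin σ)) : Finset ℕ :=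
  (Finset.range (Q.length + 1)).filter fun i => P <+: Q.drop i

/-- The reported words are exactly the occurrences of `P` in `Q`, each reported once. -/
def ReportsOccurrences {w σ : ℕ} (P Q : List (Fin σ)) (out : List (BitVec w)) : Prop :=
  out.Nodup ∧ ∀ i : ℕ, i ∈ out.map BitVec.toNat ↔ i ∈ occurrences P Q

end PackedMatching

/-!
Let `q` be the largest number such that the `2 ^ (3 * q * b)` codes of blocks of `3 * q` characters
index a table of at most `t` words, and `3 * q` characters fit into a word; then `q` is
`Ω(log_σ t)`. Unless the text is so short that it can be read character by character, a constant
number of steps is spent on every `q` characters of the text, on every candidate and on every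
occurrence.

An anchor is a block of at most `2 * q` characters of the pattern such that, if it is found where an
occurrence at `s` would have it, but there is no occurrence at `s`, then there is none at distance
less than `q` after `s` either. If the first `2 * q` characters of the pattern have no period less
than `q`, they are an anchor; otherwise the block that ends where the period breaks is one, and
where the period never breaks the first `2 * q` characters are again. The periods are read off the
prefix table (the `Z`-function) of the pattern.

The table, indexed by the codes of blocks of `3 * q` characters, gives the least shift below `q` at
which the anchor is found, so that one lookup leads to the first candidate among the next `q`
positions; if this turns out not to be an occurrence, then there is none within distance `q` after
it. A candidate is compared with the pattern `q` characters at a time. The stretch of text that is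
known to match a prefix of the pattern is never compared again, since the prefix table decides
whether a candidate in it agrees with it.
-/

namespace PackedMatching

/-! ### Codes of blocks of characters -/

/-- The number whose base `2 ^ b` digits are `f i, …, f (i + c - 1)`, lowest digit first. It is how
a block of `c` characters is held in one word. -/
def blockCode (b : ℕ) (f : ℕ → ℕ) (i c : ℕ) : ℕ := ∑ j ∈ Finset.range c, f (i + j) * 2 ^ (j * b)

section BlockCode

variable {b : ℕ} {f g : ℕ → ℕ}

theorem blockCode_add (b : ℕ) (f : ℕ → ℕ) (i c d : ℕ) :
    blockCode b f i (c + d) = blockCode b f i c + 2 ^ (c * b) * blockCode b f (i + c) d := by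
  simp only [blockCode, Finset.sum_range_add, Finset.mul_sum, add_mul, pow_add, ← add_assoc]
  congr 1
  exact Finset.sum_congr rfl fun j _ => by ring

theorem blockCode_one (b : ℕ) (f : ℕ → ℕ) (i : ℕ) : blockCode b f i 1 = f i := by
  simp [blockCode]

theorem blockCode_lt (hf : ∀ i, f i < 2 ^ b) (i c : ℕ) : blockCode b f i c < 2 ^ (c * b) := by
  induction c with
  | zero => simp [blockCode]
  | succ c ih =>
    rw [blockCode_add, blockCode_one, add_mul, one_mul, pow_add]
    calc blockCode b f i c + 2 ^ (c * b) * f (i + c)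
        < 2 ^ (c * b) + 2 ^ (c * b) * f (i + c) := by gcongr
      _ = 2 ^ (c * b) * (f (i + c) + 1) := by ring
      _ ≤ 2 ^ (c * b) * 2 ^ b := by gcongr; exact hf _

theorem blockCode_mod (hf : ∀ i, f i < 2 ^ b) (i : ℕ) {c c' : ℕ} (h : c' ≤ c) :
    blockCode b f i c % 2 ^ (c' * b) = blockCode b f i c' := by
  obtain ⟨d, rfl⟩ := Nat.exists_eq_add_of_le h
  rw [blockCode_add, Nat.add_mul_mod_self_left, Nat.mod_eq_of_lt (blockCode_lt hf i c')]

theorem blockCode_div (hf : ∀ i, f i < 2 ^ b) (i : ℕ) {c r : ℕ} (h : r ≤ c) :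
    blockCode b f i c / 2 ^ (r * b) = blockCode b f (i + r) (c - r) := by
  obtain ⟨d, rfl⟩ := Nat.exists_eq_add_of_le h
  rw [blockCode_add, Nat.add_mul_div_left _ _ (by positivity),
    Nat.div_eq_of_lt (blockCode_lt hf i r), zero_add, Nat.add_sub_cancel_left]

theorem blockCode_eq_iff (hf : ∀ i, f i < 2 ^ b) (hg : ∀ i, g i < 2 ^ b) (i i' c : ℕ) :
    blockCode b f i c = blockCode b g i' c ↔ ∀ j < c, f (i + j) = g (i' + j) := by
  constructor
  · intro h j hj
    have hdigit : blockCode b f i c / 2 ^ (j * b) % 2 ^ (1 * b) =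
        blockCode b g i' c / 2 ^ (j * b) % 2 ^ (1 * b) := by rw [h]
    rwa [blockCode_div hf _ hj.le, blockCode_div hg _ hj.le, blockCode_mod hf _ (by omega),
      blockCode_mod hg _ (by omega), blockCode_one, blockCode_one] at hdigit
  · intro h
    exact Finset.sum_congr rfl fun j hj => by rw [h j (Finset.mem_range.1 hj)]

theorem blockCode_or_shift (hf : ∀ i, f i < 2 ^ b) {w : ℕ} (i : ℕ) {c : ℕ} (hc : c * b ≤ w)
    (d : ℕ) :
    blockCode b f i c ||| blockCode b f (i + c) d * 2 ^ (c * b) % 2 ^ w =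
      blockCode b f i (c + d) % 2 ^ w := by
  have hlow := blockCode_lt hf i c
  have hw : blockCode b f i c < 2 ^ w := hlow.trans_le (Nat.pow_le_pow_right two_pos hc)
  conv_lhs => rw [← Nat.mod_eq_of_lt hw]
  rw [← Nat.or_mod_two_pow, blockCode_add, Nat.add_comm (blockCode b f i c),
    Nat.two_pow_add_eq_or_of_lt hlow, mul_comm (2 ^ _), Nat.or_comm]

theorem mod_shifted_one {w e x : ℕ} (he : e ≤ w) (hx : x < 2 ^ w) :
    x % (1 * 2 ^ e % 2 ^ w) = x % 2 ^ e := by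
  rw [one_mul]
  rcases he.eq_or_lt with rfl | h
  · rw [Nat.mod_self, Nat.mod_zero, Nat.mod_eq_of_lt hx]
  · rw [Nat.mod_eq_of_lt (Nat.pow_lt_pow_right one_lt_two h)]

/-- Two consecutive words of the packed representation determine every block of at most `k`
characters. For `c * b = w` the mask `2 ^ (c * b)` overflows to `0`, and `x % 0 = x` is what is
wanted. -/
theorem blockCode_window (hf : ∀ i, f i < 2 ^ b) {w k : ℕ} (hk : 1 ≤ k) (hw : k * b ≤ w) (p : ℕ)
    {c : ℕ} (hc : c ≤ k) :
    (blockCode b f (p / k * k) k / 2 ^ (p % k * b) |||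
      blockCode b f ((p / k + 1) * k) k * 2 ^ ((k - p % k) * b) % 2 ^ w) %
        (1 * 2 ^ (c * b) % 2 ^ w) = blockCode b f p c := by
  have hr : p % k < k := Nat.mod_lt _ hk
  have hp : p / k * k + p % k = p := Nat.div_add_mod' p k
  have hcw : c * b ≤ w := (Nat.mul_le_mul_right b hc).trans hw
  have hkw : (k - p % k) * b ≤ w := (Nat.mul_le_mul_right b (Nat.sub_le k _)).trans hw
  rw [blockCode_div hf _ hr.le, hp, show (p / k + 1) * k = p + (k - p % k) by
    rw [add_mul]; omega, blockCode_or_shift hf p hkw,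
    mod_shifted_one hcw (Nat.mod_lt _ (by positivity)), Nat.mod_mod_of_dvd _ (pow_dvd_pow 2 hcw),
    blockCode_mod hf _ (by omega)]

end BlockCode

/-! ### Prefix tables, anchors and shifts -/

/-- The pattern `g` of length `m` occurs at position `s` of the text `f`. -/
def MatchAt (f g : ℕ → ℕ) (m s : ℕ) : Prop := ∀ j < m, f (s + j) = g j

/-- `z` is the length of the longest common prefix of `g`, a string of length `m`, and its suffix
starting at `d`: the value at `d` of the `Z`-function of `g`. -/
structure IsPrefixLen (g : ℕ → ℕ) (m d z : ℕ) : Prop where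
  le : d + z ≤ m
  agree : ∀ j < z, g (d + j) = g j
  differ : d + z < m → g (d + z) ≠ g z

/-- The block of `l` characters of `g` at offset `o` is an anchor for distance `q`: whenever it is
found where an occurrence at `s` would have it, but `g` does not occur at `s`, there is no
occurrence at distance less than `q` after `s`. -/
structure IsAnchor (g : ℕ → ℕ) (m q o l : ℕ) : Prop where
  le : o + l ≤ m
  skip : ∀ (f : ℕ → ℕ) (s : ℕ), (∀ j < l, f (s + o + j) = g (o + j)) → ¬ MatchAt f g m s →
    ∀ d, 0 < d → d < q → ¬ MatchAt f g m (s + d)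

section Anchors

variable {f g : ℕ → ℕ} {m q p z : ℕ}

theorem isAnchor_one (g : ℕ → ℕ) (m : ℕ) : IsAnchor g m 1 0 0 :=
  ⟨by omega, fun _ _ _ _ d h1 h2 => by omega⟩

theorem isAnchor_self (g : ℕ → ℕ) (m q : ℕ) : IsAnchor g m q 0 m :=
  ⟨by omega, fun _ _ hfound hno => absurd (fun j hj => by simpa using hfound j hj) hno⟩

theorem isAnchor_of_aperiodic {Z : ℕ → ℕ} (hq : 2 * q ≤ m)
    (hZ : ∀ d < m, IsPrefixLen g m d (Z d)) (hper : ∀ p, 0 < p → p < q → p + Z p < 2 * q) :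
    IsAnchor g m q 0 (2 * q) := by
  refine ⟨by omega, fun f s hfound _ d hd hdq hmatch => ?_⟩
  have hlt := hper d hd hdq
  have hf : f (s + 0 + (d + Z d)) = g (0 + (d + Z d)) := hfound (d + Z d) (by omega)
  have hf' : f (s + d + Z d) = g (Z d) := hmatch (Z d) (by omega)
  simp only [add_zero, zero_add, ← add_assoc] at hf
  exact (hZ d (by omega)).differ (by omega) (hf.symm.trans hf')

/-- An occurrence at distance `d < q` would give the block period `d`. Without its last character
the block has period `p`, so the two periods would carry over to its last character, at which the
period `p` breaks. -/
theorem isAnchor_of_break (hp : p < q) (hz : IsPrefixLen g m p z) (h : 2 * q ≤ p + z)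
    (hm : p + z < m) : IsAnchor g m q (p + z + 1 - 2 * q) (2 * q) := by
  refine ⟨by omega, fun f s hfound _ d hd hdq hmatch => hz.differ hm ?_⟩
  have period_d : ∀ x, p + z + 1 - 2 * q ≤ x → x + d ≤ p + z → g (x + d) = g x := by
    intro x hx hxd
    have hf := hfound (x + d - (p + z + 1 - 2 * q)) (by omega)
    rw [show p + z + 1 - 2 * q + (x + d - (p + z + 1 - 2 * q)) = x + d by omega,
      show s + (p + z + 1 - 2 * q) + (x + d - (p + z + 1 - 2 * q)) = s + d + x by omega] at hf
    exact hf.symm.trans (hmatch x (by omega))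
  calc g (p + z) = g (p + z - d + d) := by rw [show p + z - d + d = p + z by omega]
    _ = g (p + z - d) := period_d _ (by omega) (by omega)
    _ = g (p + (z - d)) := by rw [show p + (z - d) = p + z - d by omega]
    _ = g (z - d) := hz.agree _ (by omega)
    _ = g (z - d + d) := (period_d _ (by omega) (by omega)).symm
    _ = g z := by rw [show z - d + d = z by omega]

/-- The occurrence at distance `d < q` and the prefix of length `2 * q` at `s` overlap in more than
a period, which extends the match at `s` to all of `g`. -/
theorem isAnchor_of_periodic (hp0 : 0 < p) (hp : p < q) (hz : IsPrefixLen g m p z)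
    (h : 2 * q ≤ p + z) (hm : p + z = m) : IsAnchor g m q 0 (2 * q) := by
  refine ⟨by omega, fun f s hfound hno d hd hdq hmatch => hno fun j => ?_⟩
  induction j using Nat.strong_induction_on with
  | _ j ih =>
    intro hj
    by_cases hj2 : j < 2 * q
    · simpa using hfound j hj2
    · calc f (s + j) = f (s + d + (j - d)) := by rw [show s + d + (j - d) = s + j by omega]
        _ = g (j - d) := hmatch _ (by omega)
        _ = g (p + (j - d - p)) := by rw [show p + (j - d - p) = j - d by omega]
        _ = g (j - d - p) := hz.agree _ (by omega)
        _ = f (s + d + (j - d - p)) := (hmatch _ (by omega)).symm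
        _ = f (s + (j - p)) := by rw [show s + d + (j - d - p) = s + (j - p) by omega]
        _ = g (j - p) := ih _ (by omega) (by omega)
        _ = g (p + (j - p)) := (hz.agree _ (by omega)).symm
        _ = g j := by rw [show p + (j - p) = j by omega]

end Anchors

section Boxes

variable {f g : ℕ → ℕ} {m l r i z : ℕ}

theorem isPrefixLen_zero (g : ℕ → ℕ) (m : ℕ) : IsPrefixLen g m 0 m :=
  ⟨by omega, by simp, by omega⟩

theorem IsPrefixLen.of_box (hli : l ≤ i) (hbox : ∀ x, l + x < r → g (l + x) = g x) (hr : r ≤ m)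
    (hz : IsPrefixLen g m (i - l) z) (h : z < r - i) : IsPrefixLen g m i z := by
  have hshift : ∀ j, i + j < r → g (i + j) = g (i - l + j) := fun j hj => by
    rw [← hbox (i - l + j) (by omega), show l + (i - l + j) = i + j by omega]
  refine ⟨by omega, fun j hj => (hshift j (by omega)).trans (hz.agree j hj), fun _ => ?_⟩
  rw [hshift z (by omega)]
  exact hz.differ (by omega)

theorem box_shift (hli : l ≤ i) (hbox : ∀ x, l + x < r → f (l + x) = g x)
    (hz : IsPrefixLen g m (i - l) z) (h : r - i ≤ z) : ∀ x, i + x < r → f (i + x) = g x := by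
  intro x hx
  rw [← hz.agree x (by omega), ← hbox (i - l + x) (by omega),
    show l + (i - l + x) = i + x by omega]

theorem not_matchAt_of_box (hli : l ≤ i) (hr : r ≤ l + m)
    (hbox : ∀ x, l + x < r → f (l + x) = g x) (hz : IsPrefixLen g m (i - l) z) (h : z < r - i) :
    ¬ MatchAt f g m i := by
  intro hmatch
  refine hz.differ (by omega) ?_
  rw [← hmatch z (by omega), ← hbox (i - l + z) (by omega),
    show l + (i - l + z) = i + z by omega]

end Boxes

/-- `d` is the least shift below `q` at which the lowest `l` digits in base `2 ^ b` of `c` are those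
of `u`, and `q` if there is none. -/
structure IsShift (b q l u c d : ℕ) : Prop where
  le : d ≤ q
  ne : ∀ e < d, c / 2 ^ (e * b) % 2 ^ (l * b) ≠ u
  eq : d < q → c / 2 ^ (d * b) % 2 ^ (l * b) = u

section Shifts

variable {b q l u c d : ℕ}

theorem IsShift.of_eq (h : c % 2 ^ (l * b) = u) : IsShift b q l u c 0 :=
  ⟨by omega, by simp, fun _ => by simpa using h⟩

theorem isShift_zero (h : u ≠ 0) : IsShift b q l u 0 q :=
  ⟨le_rfl, by simpa using fun _ _ => h.symm, by simp⟩

theorem div_two_pow_div (b c e : ℕ) : c / 2 ^ b / 2 ^ (e * b) = c / 2 ^ ((e + 1) * b) := by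
  rw [Nat.div_div_eq_div_mul, ← pow_add, add_mul, one_mul, add_comm b]

theorem IsShift.step (h : c % 2 ^ (l * b) ≠ u) (hd : IsShift b q l u (c / 2 ^ b) d) :
    IsShift b q l u c (if d < q then d + 1 else q) := by
  have hne : ∀ e ≤ d, c / 2 ^ (e * b) % 2 ^ (l * b) ≠ u := by
    rintro (_ | e) he
    · simpa using h
    · simpa only [div_two_pow_div] using hd.ne e he
  split_ifs with hq
  · exact ⟨hq, fun e he => hne e (by omega),
      fun _ => by simpa only [div_two_pow_div] using hd.eq hq⟩
  · have := hd.le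
    exact ⟨le_rfl, fun e he => hne e (by omega), by simp⟩

end Shifts

/-! ### An imperative language compiled to the word RAM -/

/-- The program variables, each kept in the register of its index. The first five hold the
parameters of the problem, as in `initState`. -/
inductive Var where
  | m | n | t | b | k | q | flag | tableSize | pos | lo | hi | bound | alive | tmp | period | offset
  | anchorLen | anchorCode | code | done | last | shift | cand | step | one
  deriving DecidableEq

/-- The register of a variable. Registers from `32` on hold intermediate results. -/
def Var.reg (x : Var) : ℕ := x.ctorIdx

theorem Var.reg_lt (x : Var) : x.reg < 32 := by
  cases x <;> decide

theorem Var.reg_injective : Function.Injective Var.reg :=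
  Function.LeftInverse.injective (g := Var.ofNat) Var.ofNat_ctorIdx

/-- The part of a machine state that programs of the language depend on, with words read as natural
numbers. -/
@[ext] structure View where
  r : Var → ℕ
  mem : ℕ → ℕ
  out : List ℕ

/-- The view of a machine state. Addresses that are not words read as `0`. -/
def State.view {w : ℕ} (s : State w) : View where
  r x := (s.regs x.reg).toNat
  mem a := if a < 2 ^ w then (s.mem (BitVec.ofNat w a)).toNat else 0
  out := s.out.map BitVec.toNat

/-- The view after the assignment of a value to a variable. -/
def View.set (v : View) (d : Var) (x : ℕ) : View := { v with r := Function.update v.r d x }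

/-- The view after a store to the working memory. -/
def View.store (v : View) (a x : ℕ) : View := { v with mem := Function.update v.mem a x }

/-- The view after a report. -/
def View.report (v : View) (x : ℕ) : View := { v with out := v.out ++ [x] }

section View

variable (v : View) (d : Var) (a x : ℕ)

@[simp] theorem View.set_r (y : Var) : (v.set d x).r y = if y = d then x else v.r y := by
  simp [View.set, Function.update_apply]

@[simp] theorem View.set_mem : (v.set d x).mem = v.mem := rfl

@[simp] theorem View.set_out : (v.set d x).out = v.out := rfl

@[simp] theorem View.set_set (y : ℕ) : (v.set d x).set d y = v.set d y := by
  simp [View.set]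

@[simp] theorem View.store_r : (v.store a x).r = v.r := rfl

@[simp] theorem View.store_mem : (v.store a x).mem = Function.update v.mem a x := rfl

@[simp] theorem View.report_r : (v.report x).r = v.r := rfl

end View

/-- Expressions; `load`, `pat` and `txt` read the working memory and the two packed strings. -/
inductive Expr where
  | var (x : Var)
  | lit (c : ℕ)
  | bin (o : BinOp) (a b : Expr)
  | load (a : Expr)
  | pat (a : Expr)
  | txt (a : Expr)

instance : Coe Var Expr := ⟨.var⟩
instance (c : ℕ) : OfNat Expr c := ⟨.lit c⟩
instance : Add Expr := ⟨.bin .add⟩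
instance : Sub Expr := ⟨.bin .sub⟩
instance : Mul Expr := ⟨.bin .mul⟩
instance : Div Expr := ⟨.bin .div⟩
instance : Mod Expr := ⟨.bin .mod⟩
instance : OrOp Expr := ⟨.bin .or⟩

infixl:75 "≪" => Expr.bin BinOp.shl

infixl:75 "≫" => Expr.bin BinOp.shr

/-- The values of the operations on natural numbers, in the absence of overflow. -/
def BinOp.val (w : ℕ) : BinOp → ℕ → ℕ → ℕ
  | .add, x, y => x + y
  | .sub, x, y => x - y
  | .mul, x, y => x * y
  | .div, x, y => x / y
  | .mod, x, y => x % y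
  | .and, x, y => x &&& y
  | .or, x, y => x ||| y
  | .xor, x, y => x ^^^ y
  | .shl, x, y => x * 2 ^ y % 2 ^ w
  | .shr, x, y => x / 2 ^ y

/-- The condition under which `BinOp.val` describes the operation of the machine. -/
def BinOp.Ok (w : ℕ) : BinOp → ℕ → ℕ → Prop
  | .add, x, y => x + y < 2 ^ w
  | .sub, x, y => y ≤ x
  | .mul, x, y => x * y < 2 ^ w
  | _, _, _ => True

theorem BinOp.toNat_eval {w : ℕ} (o : BinOp) (x y : BitVec w) (h : o.Ok w x.toNat y.toNat) :
    (o.eval x y).toNat = o.val w x.toNat y.toNat := by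
  cases o <;> simp only [BinOp.eval, BinOp.val, BinOp.Ok] at *
  case add => rw [BitVec.toNat_add, Nat.mod_eq_of_lt h]
  case sub => rw [BitVec.toNat_sub_of_le h]
  case mul => rw [BitVec.toNat_mul, Nat.mod_eq_of_lt h]
  case div => exact BitVec.toNat_udiv
  case mod => exact BitVec.toNat_umod
  case and => exact BitVec.toNat_and x y
  case or => exact BitVec.toNat_or x y
  case xor => exact BitVec.toNat_xor x y
  case shl => rw [BitVec.toNat_shiftLeft, Nat.shiftLeft_eq]
  case shr => rw [BitVec.toNat_ushiftRight, Nat.shiftRight_eq_div_pow]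

/-- The value of an expression on natural numbers, in the absence of overflow. -/
def Expr.val {w : ℕ} (inp : Input w) (v : View) : Expr → ℕ
  | .var x => v.r x
  | .lit c => c
  | .bin o a b => o.val w (a.val inp v) (b.val inp v)
  | .load a => v.mem (a.val inp v)
  | .pat a => (inp.pat (a.val inp v)).toNat
  | .txt a => (inp.txt (a.val inp v)).toNat

/-- The evaluation of the expression overflows nowhere and accesses only the `S` words of working
memory. -/
def Expr.Safe {w : ℕ} (inp : Input w) (S : ℕ) (v : View) : Expr → Prop
  | .var _ => True
  | .lit c => c < 2 ^ w
  | .bin o a b => a.Safe inp S v ∧ b.Safe inp S v ∧ o.Ok w (a.val inp v) (b.val inp v)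
  | .load a => a.Safe inp S v ∧ a.val inp v < S
  | .pat a => a.Safe inp S v
  | .txt a => a.Safe inp S v

/-- The program that evaluates an expression into register `t`, changing only registers from `t`
on. -/
def Expr.compile : Expr → ℕ → Program
  | .var x, t => .instr (.move t (.reg x.reg))
  | .lit c, t => .instr (.move t (.lit c))
  | .bin o a b, t =>
      .seq (.seq (a.compile t) (b.compile (t + 1))) (.instr (.op o t (.reg t) (.reg (t + 1))))
  | .load a, t => .seq (a.compile t) (.instr (.load t (.reg t)))
  | .pat a, t => .seq (a.compile t) (.instr (.readPat t (.reg t)))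
  | .txt a, t => .seq (a.compile t) (.instr (.readTxt t (.reg t)))

/-- The number of steps of the compiled expression. -/
def Expr.cost : Expr → ℕ
  | .var _ => 1
  | .lit _ => 1
  | .bin _ a b => a.cost + b.cost + 1
  | .load a => a.cost + 1
  | .pat a => a.cost + 1
  | .txt a => a.cost + 1

/-- The program `p` computes `x` into register `t` in `T` steps, taking the state `s` to `s'` and
changing nothing but registers from `t` on. -/
structure Computes {w : ℕ} (inp : Input w) (S : ℕ) (p : Program) (T t x : ℕ) (s s' : State w) :
    Prop where
  exec : Exec inp S p s T s'
  value : (s'.regs t).toNat = x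
  regs : ∀ j < t, s'.regs j = s.regs j
  mem : s'.mem = s.mem
  out : s'.out = s.out

section Compile

variable {w : ℕ} {inp : Input w} {S : ℕ} {s s₁ s₂ : State w}

theorem State.setReg_regs (s : State w) (d : ℕ) (v : BitVec w) (j : ℕ) :
    (s.setReg d v).regs j = if j = d then v else s.regs j := by
  simp [State.setReg, Function.update_apply]

theorem State.view_mem_toNat (s : State w) (a : BitVec w) :
    s.view.mem a.toNat = (s.mem a).toNat := by
  simp [State.view, a.isLt]

theorem State.view_setReg (s : State w) (d : Var) (x : BitVec w) :
    (s.setReg d.reg x).view = s.view.set d x.toNat := by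
  ext y
  · simp only [State.view, View.set_r, State.setReg_regs, Var.reg_injective.eq_iff,
      apply_ite BitVec.toNat]
  · rfl
  · rfl

theorem State.view_store (s : State w) (a x : BitVec w) :
    { s with mem := Function.update s.mem a x }.view = s.view.store a.toNat x.toNat := by
  ext i
  · rfl
  · simp only [State.view, View.store_mem, Function.update_apply]
    by_cases hi : i < 2 ^ w
    · have hia : BitVec.ofNat w i = a ↔ i = a.toNat := by
        rw [← BitVec.toNat_inj, BitVec.toNat_ofNat, Nat.mod_eq_of_lt hi]
      simp only [hi, if_true, hia, apply_ite BitVec.toNat]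
    · have : i ≠ a.toNat := fun h => hi (h ▸ a.isLt)
      simp [hi, this]
  · rfl

variable {p p' : Program} {T T' t x y : ℕ}

theorem Computes.view_eq (h : Computes inp S p T t x s s₁) (ht : 32 ≤ t) : s₁.view = s.view := by
  ext i
  · simp only [State.view, h.regs _ (i.reg_lt.trans_le ht)]
  · simp only [State.view, h.mem]
  · simp only [State.view, h.out]

theorem Computes.setReg (h : Computes inp S p T t x s s₁) {i : Instr} {z : BitVec w}
    (hi : i.eval inp S s₁ = some (s₁.setReg t z)) (hz : z.toNat = y) :
    Computes inp S (.seq p (.instr i)) (T + 1) t y s (s₁.setReg t z) where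
  exec := .seq h.exec (.instr hi)
  value := by simp [State.setReg_regs, hz]
  regs j hj := by rw [State.setReg_regs, if_neg hj.ne, h.regs j hj]
  mem := h.mem
  out := h.out

theorem computes_move {a : Operand} (ha : (a.eval s).toNat = x) :
    Computes inp S (.instr (.move t a)) 1 t x s (s.setReg t (a.eval s)) where
  exec := .instr rfl
  value := by simp [State.setReg_regs, ha]
  regs j hj := by rw [State.setReg_regs, if_neg hj.ne]
  mem := rfl
  out := rfl

theorem Computes.seq (h : Computes inp S p T t x s s₁)
    (h' : Computes inp S p' T' (t + 1) y s₁ s₂) :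
    Computes inp S (.seq p p') (T + T') t x s s₂ where
  exec := .seq h.exec h'.exec
  value := by rw [h'.regs t t.lt_succ_self, h.value]
  regs j hj := (h'.regs j (hj.trans t.lt_succ_self)).trans (h.regs j hj)
  mem := h'.mem.trans h.mem
  out := h'.out.trans h.out

theorem Expr.exists_computes (e : Expr) {t : ℕ} (ht : 32 ≤ t) {s : State w}
    (hs : e.Safe inp S s.view) :
    ∃ s', Computes inp S (e.compile t) e.cost t (e.val inp s.view) s s' := by
  induction e generalizing t s with
  | var x => exact ⟨_, computes_move rfl⟩
  | lit c => exact ⟨_, computes_move (Nat.mod_eq_of_lt hs)⟩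
  | bin o a b iha ihb =>
    obtain ⟨s₁, ha⟩ := iha ht hs.1
    have hview := ha.view_eq ht
    obtain ⟨s₂, hb⟩ := ihb (Nat.le_succ_of_le ht) (hview ▸ hs.2.1)
    rw [hview] at hb
    have hab := ha.seq hb
    refine ⟨_, hab.setReg rfl ?_⟩
    simp only [Operand.eval]
    rw [BinOp.toNat_eval, hab.value, hb.value]
    · rfl
    · rw [hab.value, hb.value]
      exact hs.2.2
  | load a iha =>
    obtain ⟨s₁, ha⟩ := iha ht hs.1
    refine ⟨_, ha.setReg (if_pos ?_) ?_⟩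
    · simpa only [Operand.eval, ha.value] using hs.2
    · rw [Expr.val, ← ha.value, State.view_mem_toNat, ha.mem, Operand.eval]
  | pat a iha =>
    obtain ⟨s₁, ha⟩ := iha ht hs
    exact ⟨_, ha.setReg rfl (by simp only [Operand.eval, ha.value, Expr.val])⟩
  | txt a iha =>
    obtain ⟨s₁, ha⟩ := iha ht hs
    exact ⟨_, ha.setReg rfl (by simp only [Operand.eval, ha.value, Expr.val])⟩

end Compile

/-- The comparisons that loop-free commands branch on. -/
inductive Comparison where
  | lt
  | eq

/-- The test of the machine for a comparison. -/
def Comparison.test : Comparison → Operand → Operand → Test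
  | .lt => .lt
  | .eq => .eq

/-- The meaning of a comparison on natural numbers. -/
def Comparison.Holds : Comparison → ℕ → ℕ → Prop
  | .lt, x, y => x < y
  | .eq, x, y => x = y

instance : (r : Comparison) → (x y : ℕ) → Decidable (r.Holds x y)
  | .lt, x, y => inferInstanceAs (Decidable (x < y))
  | .eq, x, y => inferInstanceAs (Decidable (x = y))

/-- Loop-free commands. -/
inductive Cmd where
  | assign (d : Var) (e : Expr)
  | store (a e : Expr)
  | report (e : Expr)
  | seq (c c' : Cmd)
  | ite (r : Comparison) (a b : Expr) (c c' : Cmd)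

infix:45 "::=" => Cmd.assign

infixr:40 ";;" => Cmd.seq

/-- The translation of commands to programs of the machine. -/
def Cmd.compile : Cmd → Program
  | .assign d e => .seq (e.compile 32) (.instr (.move d.reg (.reg 32)))
  | .store a e => .seq (.seq (a.compile 32) (e.compile 33)) (.instr (.store (.reg 32) (.reg 33)))
  | .report e => .seq (e.compile 32) (.instr (.report (.reg 32)))
  | .seq c c' => .seq c.compile c'.compile
  | .ite r a b c c' => .seq (.seq (a.compile 32) (b.compile 33))
      (.branch (r.test (.reg 32) (.reg 33)) c.compile c'.compile)

/-- A bound on the number of steps of the compiled command. -/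
def Cmd.cost : Cmd → ℕ
  | .assign _ e => e.cost + 1
  | .store a e => a.cost + e.cost + 1
  | .report e => e.cost + 1
  | .seq c c' => c.cost + c'.cost
  | .ite _ a b c c' => a.cost + b.cost + 1 + max c.cost c'.cost

/-- The effect of a command on natural numbers, in the absence of overflow. -/
def Cmd.run {w : ℕ} (inp : Input w) : Cmd → View → View
  | .assign d e, v => v.set d (e.val inp v)
  | .store a e, v => v.store (a.val inp v) (e.val inp v)
  | .report e, v => v.report (e.val inp v)
  | .seq c c', v => c'.run inp (c.run inp v)
  | .ite r a b c c', v =>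
      if r.Holds (a.val inp v) (b.val inp v) then c.run inp v else c'.run inp v

/-- The command overflows nowhere and accesses only the `S` words of working memory. -/
def Cmd.Safe {w : ℕ} (inp : Input w) (S : ℕ) : Cmd → View → Prop
  | .assign _ e, v => e.Safe inp S v
  | .store a e, v => a.Safe inp S v ∧ e.Safe inp S v ∧ a.val inp v < S
  | .report e, v => e.Safe inp S v
  | .seq c c', v => c.Safe inp S v ∧ c'.Safe inp S (c.run inp v)
  | .ite r a b c c', v => a.Safe inp S v ∧ b.Safe inp S v ∧
      if r.Holds (a.val inp v) (b.val inp v) then c.Safe inp S v else c'.Safe inp S v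

section Commands

variable {w : ℕ} {inp : Input w} {S : ℕ}

theorem Comparison.eval_test (r : Comparison) (s : State w) (i j : ℕ) :
    (r.test (.reg i) (.reg j)).eval s ↔ r.Holds (s.regs i).toNat (s.regs j).toNat := by
  cases r
  · rfl
  · exact BitVec.toNat_inj.symm

theorem Expr.exists_computes_pair {a b : Expr} {s : State w} (ha : a.Safe inp S s.view)
    (hb : b.Safe inp S s.view) :
    ∃ s', Computes inp S (.seq (a.compile 32) (b.compile 33)) (a.cost + b.cost) 32
        (a.val inp s.view) s s' ∧ (s'.regs 33).toNat = b.val inp s.view := by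
  obtain ⟨s₁, h₁⟩ := a.exists_computes le_rfl ha
  have hview := h₁.view_eq le_rfl
  obtain ⟨s₂, h₂⟩ := b.exists_computes (t := 33) (by omega) (hview ▸ hb)
  rw [hview] at h₂
  exact ⟨s₂, h₁.seq h₂, h₂.value⟩

theorem Cmd.exec_compile (c : Cmd) {s : State w} (hs : c.Safe inp S s.view) :
    ∃ T s', Exec inp S c.compile s T s' ∧ T ≤ c.cost ∧ s'.view = c.run inp s.view := by
  induction c generalizing s with
  | assign d e =>
    obtain ⟨s₁, he⟩ := e.exists_computes le_rfl hs
    refine ⟨_, _, .seq he.exec (.instr rfl), le_rfl, ?_⟩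
    rw [State.view_setReg, he.view_eq le_rfl, Operand.eval, he.value, Cmd.run]
  | store a e =>
    obtain ⟨s₁, hae, he⟩ := Expr.exists_computes_pair hs.1 hs.2.1
    refine ⟨_, _, .seq hae.exec (.instr (if_pos ?_)), le_rfl, ?_⟩
    · simpa only [Operand.eval, hae.value] using hs.2.2
    · rw [State.view_store, hae.view_eq le_rfl, Operand.eval, Operand.eval, hae.value, he, Cmd.run]
  | report e =>
    obtain ⟨s₁, he⟩ := e.exists_computes le_rfl hs
    refine ⟨_, _, .seq he.exec (.instr rfl), le_rfl, ?_⟩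
    rw [Cmd.run, ← he.value, ← he.view_eq le_rfl]
    simp [State.view, View.report, Operand.eval]
  | seq c c' ih ih' =>
    obtain ⟨T, s₁, hexec, hT, hview⟩ := ih hs.1
    obtain ⟨T', s₂, hexec', hT', hview'⟩ := ih' (hview ▸ hs.2)
    exact ⟨_, _, .seq hexec hexec', Nat.add_le_add hT hT', by rw [hview', hview, Cmd.run]⟩
  | ite r a b c c' ih ih' =>
    obtain ⟨ha, hb, hbranch⟩ := hs
    obtain ⟨s₁, hab, hvb⟩ := Expr.exists_computes_pair ha hb
    have htest := r.eval_test s₁ 32 33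
    rw [hab.value, hvb] at htest
    rw [Cmd.run, ← hab.view_eq le_rfl]
    rw [← hab.view_eq le_rfl] at htest hbranch
    split_ifs at hbranch ⊢ with h
    · obtain ⟨T, s₂, hexec, hT, hview⟩ := ih hbranch
      exact ⟨_, _, .seq hab.exec (.branchTrue (htest.2 h) hexec),
        by simp only [Cmd.cost]; omega, hview⟩
    · obtain ⟨T, s₂, hexec, hT, hview⟩ := ih' hbranch
      exact ⟨_, _, .seq hab.exec (.branchFalse (mt htest.1 h) hexec),
        by simp only [Cmd.cost]; omega, hview⟩

end Commands

/-- Total correctness with time credits: from every state with view `v` and a budget of `n` steps,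
`p` halts in a state that, together with the remaining budget, satisfies `Q`. -/
def WP {w : ℕ} (inp : Input w) (S : ℕ) (p : Program) (Q : View → ℕ → Prop) (v : View) (n : ℕ) :
    Prop :=
  ∀ s : State w, s.view = v → ∃ T s' n', Exec inp S p s T s' ∧ T + n' ≤ n ∧ Q s'.view n'

/-- The loop `while x < y do p`. -/
def whileLt (x y : Var) (p : Program) : Program := .loop (.lt (.reg x.reg) (.reg y.reg)) p

section WP

variable {w : ℕ} {inp : Input w} {S : ℕ} {p p' : Program} {Q Q' : View → ℕ → Prop} {v : View}
  {n N : ℕ}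

theorem WP.seq (h : WP inp S p (WP inp S p' Q) v n) : WP inp S (.seq p p') Q v n := by
  intro s hs
  obtain ⟨T, s₁, n₁, hexec, hT, h₁⟩ := h s hs
  obtain ⟨T', s₂, n₂, hexec', hT', h₂⟩ := h₁ s₁ rfl
  exact ⟨_, _, n₂, .seq hexec hexec', by omega, h₂⟩

theorem WP.mono (h : WP inp S p Q v n) (hQ : ∀ v n, Q v n → Q' v n) : WP inp S p Q' v n := by
  intro s hs
  obtain ⟨T, s₁, n₁, hexec, hT, h₁⟩ := h s hs
  exact ⟨T, s₁, n₁, hexec, hT, hQ _ _ h₁⟩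

theorem WP.mono_budget (h : WP inp S p Q v n) (hn : n ≤ N) : WP inp S p Q v N := by
  intro s hs
  obtain ⟨T, s₁, n₁, hexec, hT, h₁⟩ := h s hs
  exact ⟨T, s₁, n₁, hexec, hT.trans hn, h₁⟩

theorem WP.cmd {c : Cmd} (n K : ℕ) (hK : c.cost ≤ K) (hN : n + K ≤ N) (hs : c.Safe inp S v)
    (hQ : Q (c.run inp v) n) : WP inp S c.compile Q v N := by
  rintro s rfl
  obtain ⟨T, s₁, hexec, hT, hview⟩ := c.exec_compile hs
  exact ⟨T, s₁, n, hexec, by omega, hview ▸ hQ⟩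

/-- The value of `f` is the number of steps that may still be spent on the loop. -/
theorem WP.whileLt {x y : Var} {J : View → Prop} (f : View → ℕ)
    (hbody : ∀ v N, J v → v.r x < v.r y →
      ∃ c < f v, WP inp S p (fun v' N' => J v' ∧ N + f v' ≤ N') v (N + c))
    (hv : J v) : WP inp S (whileLt x y p)
      (fun v' N' => (J v' ∧ v'.r y ≤ v'.r x) ∧ N + f v' ≤ N') v (N + f v + 1) := by
  induction hf : f v using Nat.strong_induction_on generalizing v N with
  | _ a ih =>
    rintro s rfl
    by_cases h : s.view.r x < s.view.r y
    · obtain ⟨c, hc, hw⟩ := hbody _ N hv h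
      obtain ⟨T, s₁, n₁, hexec, hT, hJ, hn₁⟩ := hw s rfl
      obtain ⟨N₁, rfl⟩ := Nat.exists_eq_add_of_le' ((Nat.le_add_left _ N).trans hn₁)
      obtain ⟨T', s₂, n₂, hexec', hT', hQ, hn₂⟩ := ih _ (by omega) (N := N₁) hJ rfl s₁ rfl
      exact ⟨_, _, n₂, .loopTrue h hexec hexec', by omega, hQ, by omega⟩
    · exact ⟨_, _, N + f s.view, .loopFalse h, by omega, ⟨hv, not_lt.1 h⟩, le_rfl⟩

end WP

section Simp

variable {w : ℕ} (inp : Input w) (S : ℕ) (v : View) (a b : Expr)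

attribute [simp] Expr.val Expr.Safe BinOp.val BinOp.Ok Comparison.Holds Cmd.run Cmd.Safe

@[simp] theorem Expr.val_ofNat (c : ℕ) : Expr.val inp v (OfNat.ofNat c) = OfNat.ofNat c := rfl

@[simp] theorem Expr.val_add : (a + b).val inp v = a.val inp v + b.val inp v := rfl

@[simp] theorem Expr.val_sub : (a - b).val inp v = a.val inp v - b.val inp v := rfl

@[simp] theorem Expr.val_mul : (a * b).val inp v = a.val inp v * b.val inp v := rfl

@[simp] theorem Expr.val_div : (a / b).val inp v = a.val inp v / b.val inp v := rfl

@[simp] theorem Expr.val_mod : (a % b).val inp v = a.val inp v % b.val inp v := rfl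

@[simp] theorem Expr.val_or : (a ||| b).val inp v = a.val inp v ||| b.val inp v := rfl

@[simp] theorem Expr.safe_ofNat (c : ℕ) :
    Expr.Safe inp S v (OfNat.ofNat c) ↔ OfNat.ofNat c < 2 ^ w := Iff.rfl

@[simp] theorem Expr.safe_add : (a + b).Safe inp S v ↔
    a.Safe inp S v ∧ b.Safe inp S v ∧ a.val inp v + b.val inp v < 2 ^ w := Iff.rfl

@[simp] theorem Expr.safe_sub : (a - b).Safe inp S v ↔
    a.Safe inp S v ∧ b.Safe inp S v ∧ b.val inp v ≤ a.val inp v := Iff.rfl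

@[simp] theorem Expr.safe_mul : (a * b).Safe inp S v ↔
    a.Safe inp S v ∧ b.Safe inp S v ∧ a.val inp v * b.val inp v < 2 ^ w := Iff.rfl

@[simp] theorem Expr.safe_div : (a / b).Safe inp S v ↔ a.Safe inp S v ∧ b.Safe inp S v := by
  change _ ∧ _ ∧ True ↔ _
  rw [and_true]

@[simp] theorem Expr.safe_mod : (a % b).Safe inp S v ↔ a.Safe inp S v ∧ b.Safe inp S v := by
  change _ ∧ _ ∧ True ↔ _
  rw [and_true]

@[simp] theorem Expr.safe_or : (a ||| b).Safe inp S v ↔ a.Safe inp S v ∧ b.Safe inp S v := by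
  change _ ∧ _ ∧ True ↔ _
  rw [and_true]

end Simp

/-! ### The matching problem -/

/-- The input of the matching problem in terms of character codes: `text` and `pattern` are the
codes of the characters of the two strings, `n` and `m` the lengths, `b` the number of bits per
character, `k` the number of characters per word, `t` the parameter, and `space` the number of words
of working memory. -/
structure Problem (w : ℕ) where
  inp : Input w
  space : ℕ
  m : ℕ
  n : ℕ
  t : ℕ
  b : ℕ
  k : ℕ
  text : ℕ → ℕ
  pattern : ℕ → ℕ
  b_pos : 1 ≤ b
  k_pos : 1 ≤ k
  fits : k * b ≤ w
  m_le : m ≤ n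
  n_lt : n < 2 ^ w
  t_ge : 2 ≤ t
  t_lt : t < 2 ^ w
  space_ge : t + m ≤ space
  text_lt : ∀ i, text i < 2 ^ b
  pattern_lt : ∀ i, pattern i < 2 ^ b
  inp_txt : ∀ x, (inp.txt x).toNat = blockCode b text (x * k) k
  inp_pat : ∀ x, (inp.pat x).toNat = blockCode b pattern (x * k) k

/-- The variables hold the parameters of the problem. -/
structure Params {w : ℕ} (I : Problem w) (v : View) : Prop where
  m : v.r .m = I.m
  n : v.r .n = I.n
  t : v.r .t = I.t
  b : v.r .b = I.b
  k : v.r .k = I.k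

/-- The total correctness statement for a phase of fixed cost: started in a view satisfying `P`, the
program `p` halts within `c` steps in a view satisfying `Q`. -/
def Triple {w : ℕ} (I : Problem w) (P : View → Prop) (p : Program) (c : ℕ) (Q : View → Prop) :
    Prop :=
  ∀ v N, P v → WP I.inp I.space p (fun v' N' => Q v' ∧ N ≤ N') v (N + c)

section Problem

variable {w : ℕ} {I : Problem w} {v v' : View}

theorem Params.congr (hv : Params I v)
    (h : ∀ x ∈ [Var.m, .n, .t, .b, .k], v'.r x = v.r x := by simp) : Params I v' := by
  simp only [List.forall_mem_cons] at h
  obtain ⟨hm, hn, ht, hb, hk, -⟩ := h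
  exact ⟨hm.trans hv.m, hn.trans hv.n, ht.trans hv.t, hb.trans hv.b, hk.trans hv.k⟩

theorem Triple.seq {P Q R : View → Prop} {p p' : Program} {c c' : ℕ} (h : Triple I P p c Q)
    (h' : Triple I Q p' c' R) : Triple I P (.seq p p') (c + c') R := by
  intro v N hP
  refine .seq (((h v (N + c') hP).mono_budget (by omega)).mono fun v' N' ⟨hQ, hN⟩ => ?_)
  exact (h' v' N hQ).mono_budget hN

theorem Triple.mono {P Q Q' : View → Prop} {p : Program} {c : ℕ} (h : Triple I P p c Q)
    (hQ : ∀ v, Q v → Q' v) : Triple I P p c Q' :=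
  fun v N hP => (h v N hP).mono fun v' _ h => ⟨hQ v' h.1, h.2⟩

theorem Triple.cmd {P Q : View → Prop} {c : Cmd} {K : ℕ} (hK : c.cost ≤ K)
    (hs : ∀ v, P v → c.Safe I.inp I.space v) (hQ : ∀ v, P v → Q (c.run I.inp v)) :
    Triple I P c.compile K Q :=
  fun v _ hP => .cmd _ _ hK le_rfl (hs v hP) ⟨hQ v hP, le_rfl⟩

theorem Triple.whileLt {J : View → Prop} {x y : Var} {p : Program} {K : ℕ} (f : View → ℕ)
    (hbody : ∀ v N, J v → v.r x < v.r y →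
      ∃ c < f v, WP I.inp I.space p (fun v' N' => J v' ∧ N + f v' ≤ N') v (N + c))
    (hf : ∀ v, J v → f v ≤ K) :
    Triple I J (whileLt x y p) (K + 1) (fun v => J v ∧ v.r y ≤ v.r x) := by
  intro v N hv
  have := hf v hv
  exact ((WP.whileLt f hbody hv (N := N)).mono_budget (by omega)).mono fun _ _ h => ⟨h.1, by omega⟩

theorem Problem.four_le (I : Problem w) : 4 ≤ 2 ^ w := by
  have h2 := I.t_ge.trans_lt I.t_lt
  rw [← Nat.pow_one 2, Nat.pow_lt_pow_iff_right (by norm_num)] at h2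
  calc 4 = 2 ^ 2 := by norm_num
    _ ≤ 2 ^ w := Nat.pow_le_pow_right two_pos h2

theorem Problem.w_ne_zero (I : Problem w) : w ≠ 0 := by
  rintro rfl
  exact absurd I.four_le (by norm_num)

theorem Problem.mul_b_lt (I : Problem w) {c : ℕ} (hc : c ≤ I.k) : c * I.b < 2 ^ w :=
  ((Nat.mul_le_mul_right _ hc).trans I.fits).trans_lt Nat.lt_two_pow_self

theorem Problem.div_add_one_lt (I : Problem w) {p : ℕ} (hp : p < 2 ^ w)
    (h : p + 1 < 2 ^ w ∨ 2 ≤ I.k) : p / I.k + 1 < 2 ^ w := by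
  obtain h | h := h
  · exact (Nat.add_le_add_right (Nat.div_le_self p I.k) 1).trans_lt h
  · have := I.four_le
    have := Nat.div_le_div_left (a := p) h two_pos
    omega

end Problem

/-- The code of the block of `c` characters at position `p` of the string read by `rd`. -/
def window (rd : Expr → Expr) (p c : Expr) : Expr :=
  (rd (p / Var.k) ≫ (p % Var.k * Var.b) |||
    rd (p / Var.k + 1) ≪ ((Var.k - p % Var.k) * Var.b)) % 1 ≪ (c * Var.b)

section Window

variable {w : ℕ} {I : Problem w} {v : View} {p c : Expr}

theorem val_window_txt (hv : Params I v) (hc : c.val I.inp v ≤ I.k) :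
    (window .txt p c).val I.inp v = blockCode I.b I.text (p.val I.inp v) (c.val I.inp v) := by
  simp [window, hv.b, hv.k, I.inp_txt,
    ← blockCode_window I.text_lt I.k_pos I.fits (p.val I.inp v) hc]

theorem val_window_pat (hv : Params I v) (hc : c.val I.inp v ≤ I.k) :
    (window .pat p c).val I.inp v = blockCode I.b I.pattern (p.val I.inp v) (c.val I.inp v) := by
  simp [window, hv.b, hv.k, I.inp_pat,
    ← blockCode_window I.pattern_lt I.k_pos I.fits (p.val I.inp v) hc]

theorem safe_window (rd : Expr → Expr)
    (hrd : ∀ e, (rd e).Safe I.inp I.space v ↔ e.Safe I.inp I.space v)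
    (hv : Params I v) (hp : p.Safe I.inp I.space v) (hc : c.Safe I.inp I.space v)
    (hck : c.val I.inp v ≤ I.k) (hpk : p.val I.inp v / I.k + 1 < 2 ^ w) :
    (window rd p c).Safe I.inp I.space v := by
  have hmod : p.val I.inp v % I.k ≤ I.k := (Nat.mod_lt _ I.k_pos).le
  simp [window, hrd, hv.b, hv.k, hmod, I.mul_b_lt hmod, I.mul_b_lt (Nat.sub_le _ _),
    I.mul_b_lt hck, hp, hc, hpk, I.w_ne_zero]

end Window

/-! ### Choosing the block length -/

/-- The possible values of the block length and of the mode flag. In table mode (flag `1`) blocks of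
`3 * q` characters index a table of at most `t` words, and `q` is the greatest such block length; in
scan mode (flag `0`) the text is read character by character, which is within the time bound
because no table fits or the text is short. -/
inductive IsPlan {w : ℕ} (I : Problem w) : ℕ → ℕ → Prop
  | table {q : ℕ} (pos : 1 ≤ q) (le_k : 3 * q ≤ I.k) (le_t : 2 ^ (3 * q * I.b) ≤ I.t)
      (maximal : I.k < 3 * (q + 1) ∨ I.t < 2 ^ (3 * (q + 1) * I.b)) (m_lt : 4 * I.m < I.n)
      (t_lt : 4 * I.t < I.n) : IsPlan I q 1
  | scan (h : I.n ≤ 4 * I.m + 3 ∨ I.n ≤ 4 * I.t + 3 ∨ I.k < 3 ∨ I.t < 2 ^ (3 * I.b)) : IsPlan I 1 0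

/-- A choice of the block length and of the mode of the search. -/
structure Plan {w : ℕ} (I : Problem w) where
  q : ℕ
  flag : ℕ
  isPlan : IsPlan I q flag

/-- The variables hold the parameters of the problem and of the plan. -/
structure Chosen {w : ℕ} {I : Problem w} (π : Plan I) (v : View) : Prop extends Params I v where
  q : v.r .q = π.q
  flag : v.r .flag = π.flag
  tableSize : π.flag = 1 → v.r .tableSize = 2 ^ (3 * π.q * I.b)

section Programs

open Var

/-- The start of the search for the block length. The loop bound is one more than
`t / 2 ^ (3 * b)`, computed by three shifts because `3 * b` may overflow. -/
def chooseInit : Cmd := q ::= 0 ;; tableSize ::= 1 ;; bound ::= t ≫ b ≫ b ≫ b + 1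

/-- Passing to the next block length. -/
def chooseStep : Cmd := q ::= q + 1 ;; tableSize ::= 1 ≪ (3 * q * b)

/-- The restriction of the block length to a third of a word. -/
def chooseCap : Cmd := .ite .lt (k / 3) q (q ::= k / 3) (q ::= q)

/-- The choice of the mode. The comparisons with a quarter of `n` are shifts by `2`, because the
literal `4` need not fit into a word. -/
def chooseMode : Cmd :=
  tableSize ::= 1 ≪ (3 * q * b) ;; flag ::= 0 ;;
  .ite .lt m (n ≫ 2) (.ite .lt t (n ≫ 2) (.ite .lt 0 q (flag ::= 1) (q ::= 1)) (q ::= 1)) (q ::= 1)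

/-- The choice of the block length and of the mode. -/
def choosePhase : Program :=
  .seq (.seq chooseInit.compile (whileLt tableSize bound chooseStep.compile))
    (.seq chooseCap.compile chooseMode.compile)

end Programs

section Choose

variable {w : ℕ} {I : Problem w} {v v' : View}

theorem Plan.flag_cases (π : Plan I) : π.flag = 0 ∨ π.flag = 1 := by
  obtain ⟨q, flag, h⟩ := π
  cases h <;> simp

theorem Plan.of_flag_eq_one (π : Plan I) (hflag : π.flag = 1) : 3 * π.q ≤ I.k ∧
    2 ^ (3 * π.q * I.b) ≤ I.t ∧ 4 * I.m < I.n ∧ 4 * I.t < I.n := by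
  obtain ⟨q, flag, h⟩ := π
  cases h with
  | table _ le_k le_t _ m_lt t_lt => exact ⟨le_k, le_t, m_lt, t_lt⟩
  | scan => cases hflag

theorem Plan.q_pos (π : Plan I) : 1 ≤ π.q := by
  obtain ⟨q, flag, h⟩ := π
  cases h with
  | table pos => exact pos
  | scan => exact le_rfl

theorem Plan.q_eq_one (π : Plan I) (hflag : π.flag = 0) : π.q = 1 := by
  obtain ⟨q, flag, h⟩ := π
  cases h with
  | table => cases hflag
  | scan => rfl

theorem Plan.three_mul_lt (π : Plan I) : 3 * π.q < 2 ^ w := by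
  obtain ⟨q, flag, h⟩ := π
  cases h with
  | table _ le_k =>
    exact ((le_k.trans (Nat.le_mul_of_pos_right _ I.b_pos)).trans I.fits).trans_lt
      Nat.lt_two_pow_self
  | scan => exact I.four_le

theorem Plan.q_le_k (π : Plan I) : π.q ≤ I.k := by
  obtain ⟨q, flag, h⟩ := π
  cases h with
  | table _ le_k => exact (Nat.le_mul_of_pos_left q three_pos).trans le_k
  | scan => exact I.k_pos

theorem Plan.q_le_t (π : Plan I) : π.q ≤ I.t := by
  obtain ⟨q, flag, h⟩ := π
  cases h with
  | table _ _ le_t =>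
    have : 3 * q ≤ 3 * q * I.b := Nat.le_mul_of_pos_right _ I.b_pos
    have := (Nat.lt_two_pow_self (n := 3 * q * I.b)).trans_le le_t
    change q ≤ I.t
    omega
  | scan => exact one_le_two.trans I.t_ge

theorem Chosen.congr {π : Plan I} (hv : Chosen π v)
    (h : ∀ x ∈ [Var.m, .n, .t, .b, .k, .q, .flag, .tableSize], v'.r x = v.r x := by simp) :
    Chosen π v' where
  toParams := hv.toParams.congr (by simp_all)
  q := (h _ (by simp)).trans hv.q
  flag := (h _ (by simp)).trans hv.flag
  tableSize hf := (h _ (by simp)).trans (hv.tableSize hf)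

/-- The invariant of the search for the block length. -/
structure Choosing (I : Problem w) (v : View) : Prop extends Params I v where
  out : v.out = []
  tableSize : v.r .tableSize = 2 ^ (3 * v.r .q * I.b)
  le_t : v.r .tableSize ≤ I.t
  bound : v.r .bound = I.t / 2 ^ (3 * I.b) + 1

theorem Choosing.lt_bound_iff (hv : Choosing I v) :
    v.r .tableSize < v.r .bound ↔ 2 ^ (3 * (v.r .q + 1) * I.b) ≤ I.t := by
  rw [hv.bound, Nat.lt_succ_iff, hv.tableSize, Nat.le_div_iff_mul_le (by positivity), ← pow_add]
  ring_nf

theorem Choosing.q_lt (hv : Choosing I v) : v.r .q < I.t := by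
  refine (Nat.lt_two_pow_self (n := v.r .q)).trans_le ((Nat.pow_le_pow_right two_pos ?_).trans
    (hv.tableSize ▸ hv.le_t))
  nlinarith [I.b_pos]

theorem div_two_pow_three (x b : ℕ) : x / 2 ^ b / 2 ^ b / 2 ^ b = x / 2 ^ (3 * b) := by
  rw [Nat.div_div_eq_div_mul, Nat.div_div_eq_div_mul, ← pow_add, ← pow_add]
  ring_nf

theorem triple_chooseInit :
    Triple I (fun v => Params I v ∧ v.out = []) chooseInit.compile 14 (Choosing I) := by
  refine .cmd (by decide) (fun v ⟨hv, _⟩ => ?_) fun v ⟨hv, hout⟩ => ?_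
  · have hlt : I.t / 2 ^ (3 * I.b) < I.t :=
      Nat.div_lt_self (by have := I.t_ge; omega)
        (Nat.one_lt_two_pow (by have := I.b_pos; omega))
    simp [chooseInit, hv.t, hv.b, I.w_ne_zero, div_two_pow_three,
      (Nat.succ_le_of_lt hlt).trans_lt I.t_lt]
  · exact { hv.congr (by simp [chooseInit]) with
      out := hout
      tableSize := by simp [chooseInit]
      le_t := by simpa [chooseInit] using by have := I.t_ge; omega
      bound := by simp [chooseInit, hv.t, hv.b, div_two_pow_three] }

theorem triple_chooseLoop :
    Triple I (Choosing I) (whileLt .tableSize .bound chooseStep.compile) (13 * I.t + 1)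
      (fun v => Choosing I v ∧ v.r .bound ≤ v.r .tableSize) := by
  refine .whileLt (fun v => 13 * (I.t - v.r .q)) (fun v N hv hlt => ?_) fun v _ => by omega
  have hle := hv.lt_bound_iff.1 hlt
  have hq := hv.q_lt
  have hmul : 3 * (v.r .q + 1) * I.b < I.t := Nat.lt_two_pow_self.trans_le hle
  have htw := I.t_lt
  refine ⟨13 * (I.t - (v.r .q + 1)) + 12, by omega,
    .cmd _ 12 (by decide) (add_assoc ..).le ?_ ⟨?_, ?_⟩⟩
  · have : 3 * (v.r .q + 1) ≤ 3 * (v.r .q + 1) * I.b := Nat.le_mul_of_pos_right _ I.b_pos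
    simpa [chooseStep, hv.b, I.w_ne_zero] using by omega
  · have hmod := Nat.mod_eq_of_lt (hle.trans_lt htw)
    exact { hv.congr (by simp [chooseStep]) with
      out := hv.out
      tableSize := by simp [chooseStep, hv.b, hmod]
      le_t := by simpa [chooseStep, hv.b, hmod] using hle
      bound := by simp [chooseStep, hv.bound] }
  · simp [chooseStep]

/-- The block length satisfies the requirements of table mode except that it may be `0`. -/
structure Capped (I : Problem w) (v : View) : Prop extends Params I v where
  out : v.out = []
  le_k : 3 * v.r .q ≤ I.k
  le_t : 2 ^ (3 * v.r .q * I.b) ≤ I.t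
  maximal : I.k < 3 * (v.r .q + 1) ∨ I.t < 2 ^ (3 * (v.r .q + 1) * I.b)

theorem triple_chooseCap : Triple I (fun v => Choosing I v ∧ v.r .bound ≤ v.r .tableSize)
    chooseCap.compile 9 (Capped I) := by
  refine .cmd (by decide) (fun v ⟨hv, _⟩ => ?_) fun v ⟨hv, hle⟩ => ?_
  · have := I.four_le
    simpa [chooseCap, hv.k] using by omega
  · have hle_t := hv.tableSize ▸ hv.le_t
    have hlt := not_le.1 (mt hv.lt_bound_iff.2 hle.not_gt)
    by_cases h : I.k / 3 < v.r .q
    · exact { hv.congr (by simp [chooseCap, hv.k, h]) with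
        out := by simp [chooseCap, hv.k, h, hv.out]
        le_k := by simpa [chooseCap, hv.k, h] using by omega
        le_t := by
          simpa [chooseCap, hv.k, h] using
            (Nat.pow_le_pow_right two_pos (Nat.mul_le_mul_right _ (by omega))).trans hle_t
        maximal := .inl (by simpa [chooseCap, hv.k, h] using by omega) }
    · exact { hv.congr (by simp [chooseCap, hv.k, h]) with
        out := by simp [chooseCap, hv.k, h, hv.out]
        le_k := by simpa [chooseCap, hv.k, h] using by omega
        le_t := by simpa [chooseCap, hv.k, h] using hle_t
        maximal := .inr (by simpa [chooseCap, hv.k, h] using hlt) }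

theorem Capped.two_pow_mod (hv : Capped I v) :
    2 ^ (3 * v.r .q * I.b) % 2 ^ w = 2 ^ (3 * v.r .q * I.b) :=
  Nat.mod_eq_of_lt (hv.le_t.trans_lt I.t_lt)

theorem Capped.chooseMode_run (hv : Capped I v) : chooseMode.run I.inp v =
    let v' := (v.set .tableSize (2 ^ (3 * v.r .q * I.b))).set .flag 0
    if I.m < I.n / 4 ∧ I.t < I.n / 4 ∧ 0 < v.r .q then v'.set .flag 1 else v'.set .q 1 := by
  simp [chooseMode, hv.m, hv.n, hv.t, hv.b, hv.two_pow_mod, ite_and]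

theorem triple_chooseMode : Triple I (Capped I) chooseMode.compile 31
    (fun v => ∃ π : Plan I, Chosen π v ∧ v.out = []) := by
  refine .cmd (by decide) (fun v hv => ?_) fun v hv => ?_
  · have := I.four_le
    have hkb : 3 * v.r .q * I.b ≤ w := (Nat.mul_le_mul_right _ hv.le_k).trans I.fits
    have hqb : 3 * v.r .q ≤ 3 * v.r .q * I.b := Nat.le_mul_of_pos_right _ I.b_pos
    have := Nat.lt_two_pow_self (n := w)
    simpa [chooseMode, hv.b, I.w_ne_zero] using by omega
  rw [hv.chooseMode_run]
  by_cases h : I.m < I.n / 4 ∧ I.t < I.n / 4 ∧ 0 < v.r .q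
  · rw [if_pos h]
    obtain ⟨hm, ht, hq⟩ := h
    exact ⟨⟨_, _, .table hq hv.le_k hv.le_t hv.maximal (by omega) (by omega)⟩,
      ⟨hv.congr, by simp, by simp, by simp⟩, hv.out⟩
  · rw [if_neg h]
    refine ⟨⟨1, 0, .scan ?_⟩, ⟨hv.congr, by simp, by simp, by simp⟩, hv.out⟩
    rcases Nat.eq_zero_or_pos (v.r .q) with hq | hq
    · exact .inr (.inr (by simpa [hq] using hv.maximal))
    · omega

theorem triple_choosePhase : Triple I (fun v => Params I v ∧ v.out = []) choosePhase
    (13 * I.t + 55) (fun v => ∃ π : Plan I, Chosen π v ∧ v.out = []) := by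
  rw [show 13 * I.t + 55 = 14 + (13 * I.t + 1) + (9 + 31) by omega]
  exact (triple_chooseInit.seq triple_chooseLoop).seq (triple_chooseCap.seq triple_chooseMode)

end Choose

/-! ### The prefix table of the pattern -/

section Programs

open Var

/-- The start of the computation of the prefix table. -/
def prefixInit : Cmd := .store 0 m ;; lo ::= 1 ;; hi ::= 0 ;; pos ::= 1

/-- The start of the computation of the entry for `pos`. Where the box from `lo` to `hi` does not
determine the entry, it is extended up to `bound` as a box from `pos`. -/
def prefixBegin : Cmd :=
  .ite .lt pos hi
    (tmp ::= .load (pos - lo) ;;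
      .ite .lt tmp (hi - pos) (bound ::= 0) (lo ::= pos ;; tmp ::= hi - pos ;; bound ::= m))
    (lo ::= pos ;; hi ::= pos ;; tmp ::= 0 ;; bound ::= m)

/-- The extension of the box by one character. -/
def prefixExtend : Cmd :=
  .ite .eq (window .pat hi 1) (window .pat (hi - lo) 1) (hi ::= hi + 1 ;; tmp ::= tmp + 1)
    (bound ::= 0)

/-- Storing an entry of the prefix table. -/
def prefixEnd : Cmd := .store pos tmp ;; pos ::= pos + 1

/-- The computation of one entry of the prefix table. -/
def prefixEntry : Program :=
  .seq prefixBegin.compile (.seq (whileLt hi bound prefixExtend.compile) prefixEnd.compile)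

/-- The computation of the prefix table by the `Z`-algorithm. -/
def prefixPhase : Program := .seq prefixInit.compile (whileLt pos m prefixEntry)

end Programs

section PrefixTable

variable {w : ℕ} {I : Problem w} {π : Plan I} {v v' : View}

/-- The invariant of the computation of the prefix table. -/
structure PrefixInv (π : Plan I) (v : View) : Prop extends Chosen π v where
  out : v.out = []
  lo_pos : 1 ≤ v.r .lo
  lo_le : v.r .lo ≤ v.r .pos
  hi_le : v.r .hi ≤ I.m
  box : ∀ x, v.r .lo + x < v.r .hi → I.pattern (v.r .lo + x) = I.pattern x
  table : ∀ d < I.m, d < v.r .pos → IsPrefixLen I.pattern I.m d (v.mem d)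

/-- The invariant of the extension of a box: either `tmp` is the entry sought, or the box starts at
`pos` and `tmp` is its length. -/
structure PrefixExtending (π : Plan I) (v : View) : Prop extends PrefixInv π v where
  lt : v.r .pos < I.m
  entry : v.r .bound = 0 ∧ IsPrefixLen I.pattern I.m (v.r .pos) (v.r .tmp) ∨
    v.r .bound = I.m ∧ v.r .lo = v.r .pos ∧ v.r .pos + v.r .tmp = v.r .hi

/-- The prefix table of the pattern is at the addresses below its length. -/
structure HasPrefixTable (π : Plan I) (v : View) : Prop extends Chosen π v where
  table : ∀ d < I.m, IsPrefixLen I.pattern I.m d (v.mem d)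

theorem PrefixInv.extending_restart (hv : PrefixInv π v) (hlt : v.r .pos < I.m) :
    PrefixExtending π
      ((((v.set .lo (v.r .pos)).set .hi (v.r .pos)).set .tmp 0).set .bound I.m) :=
  { hv.congr with
    out := hv.out
    lo_pos := hv.lo_pos.trans hv.lo_le
    lo_le := le_rfl
    hi_le := hlt.le
    box := fun x (hx : v.r .pos + x < v.r .pos) => by omega
    table := hv.table
    lt := hlt
    entry := .inr ⟨by simp, by simp, by simp⟩ }

theorem PrefixInv.run_prefixBegin (hv : PrefixInv π v) (hlt : v.r .pos < I.m) :
    PrefixExtending π (prefixBegin.run I.inp v) ∧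
      (prefixBegin.run I.inp v).r .pos = v.r .pos ∧
      v.r .hi ≤ (prefixBegin.run I.inp v).r .hi := by
  have hlo := hv.lo_pos
  have hle := hv.lo_le
  by_cases hpos : v.r .pos < v.r .hi
  · have hz := hv.table (v.r .pos - v.r .lo) (by omega) (by omega)
    by_cases htmp : v.mem (v.r .pos - v.r .lo) < v.r .hi - v.r .pos
    · have hrun : prefixBegin.run I.inp v =
          (v.set .tmp (v.mem (v.r .pos - v.r .lo))).set .bound 0 := by
        simp [prefixBegin, hpos, htmp]
      rw [hrun]
      exact ⟨{ hv.congr with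
        out := hv.out
        lo_pos := hlo
        lo_le := hle
        hi_le := hv.hi_le
        box := hv.box
        table := hv.table
        lt := hlt
        entry := .inl ⟨by simp, hz.of_box hle hv.box hv.hi_le htmp⟩ }, by simp, by simp⟩
    · have hrun : prefixBegin.run I.inp v = (((v.set .tmp (v.mem (v.r .pos - v.r .lo))).set .lo
          (v.r .pos)).set .tmp (v.r .hi - v.r .pos)).set .bound I.m := by
        simp [prefixBegin, hpos, htmp, hv.m]
      rw [hrun]
      exact ⟨{ hv.congr with
        out := hv.out
        lo_pos := hlo.trans hle
        lo_le := le_rfl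
        hi_le := hv.hi_le
        box := box_shift hle hv.box hz (not_lt.1 htmp)
        table := hv.table
        lt := hlt
        entry := .inr ⟨by simp, by simp, by simpa using by omega⟩ }, by simp, by simp⟩
  · have hrun : prefixBegin.run I.inp v =
        (((v.set .lo (v.r .pos)).set .hi (v.r .pos)).set .tmp 0).set .bound I.m := by
      simp [prefixBegin, hpos, hv.m]
    rw [hrun]
    exact ⟨hv.extending_restart hlt, by simp, by simpa using hpos⟩

theorem PrefixInv.safe_prefixBegin (hv : PrefixInv π v) (hlt : v.r .pos < I.m) :
    prefixBegin.Safe I.inp I.space v := by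
  have := hv.lo_le
  have := I.space_ge
  by_cases hpos : v.r .pos < v.r .hi
  · by_cases htmp : v.mem (v.r .pos - v.r .lo) < v.r .hi - v.r .pos
    · simpa [prefixBegin, hpos, htmp] using by omega
    · simpa [prefixBegin, hpos, htmp] using by omega
  · simp [prefixBegin, hpos]

theorem PrefixExtending.eq_of_lt_bound (hv : PrefixExtending π v) (hlt : v.r .hi < v.r .bound) :
    v.r .bound = I.m ∧ v.r .lo = v.r .pos ∧ v.r .pos + v.r .tmp = v.r .hi :=
  hv.entry.resolve_left fun h => by omega

theorem PrefixExtending.safe_prefixExtend (hv : PrefixExtending π v)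
    (hlt : v.r .hi < v.r .bound) : prefixExtend.Safe I.inp I.space v := by
  obtain ⟨hbound, hlo, htmp⟩ := hv.eq_of_lt_bound hlt
  have hhi : v.r .hi + 1 < 2 ^ w := by
    have := I.m_le
    have := I.n_lt
    omega
  have hdiv : ∀ p ≤ v.r .hi, p / I.k + 1 < 2 ^ w := fun p hp =>
    I.div_add_one_lt (by omega) (.inl (by omega))
  have hone : (1 : Expr).Safe I.inp I.space v := by simp [I.w_ne_zero]
  have h₁ : (window .pat Var.hi 1).Safe I.inp I.space v :=
    safe_window .pat (fun _ => Iff.rfl) hv.toParams (by simp) hone (by simpa using I.k_pos)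
      (hdiv _ le_rfl)
  have h₂ : (window .pat (Var.hi - Var.lo) 1).Safe I.inp I.space v :=
    safe_window .pat (fun _ => Iff.rfl) hv.toParams (by simpa using by omega) hone
      (by simpa using I.k_pos) (hdiv _ (Nat.sub_le _ _))
  by_cases heq : (window .pat Var.hi 1).val I.inp v = (window .pat (Var.hi - Var.lo) 1).val I.inp v
  · simpa [prefixExtend, h₁, h₂, heq, I.w_ne_zero] using by omega
  · simp [prefixExtend, h₁, h₂, heq]

theorem PrefixExtending.run_prefixExtend (hv : PrefixExtending π v)
    (hlt : v.r .hi < v.r .bound) :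
    PrefixExtending π (prefixExtend.run I.inp v) ∧
      (prefixExtend.run I.inp v).r .pos = v.r .pos ∧
      (v.r .hi < (prefixExtend.run I.inp v).r .hi ∨
        v.r .hi = (prefixExtend.run I.inp v).r .hi ∧
          (prefixExtend.run I.inp v).r .bound = 0) := by
  obtain ⟨hbound, hlo, htmp⟩ := hv.eq_of_lt_bound hlt
  have hbox : ∀ x < v.r .tmp, I.pattern (v.r .pos + x) = I.pattern x := fun x hx =>
    hlo ▸ hv.box x (by omega)
  have hval : ∀ e, (window .pat e 1).val I.inp v = I.pattern (e.val I.inp v) := fun e =>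
    (val_window_pat hv.toParams (by simpa using I.k_pos)).trans (blockCode_one _ _ _)
  by_cases heq : I.pattern (v.r .hi) = I.pattern (v.r .hi - v.r .lo)
  · have hrun : prefixExtend.run I.inp v =
        (v.set .hi (v.r .hi + 1)).set .tmp (v.r .tmp + 1) := by
      simp [prefixExtend, hval, heq]
    rw [hrun]
    exact ⟨{ hv.congr with
      out := hv.out
      lo_pos := hv.lo_pos
      lo_le := hv.lo_le
      hi_le := by simpa using by omega
      box := fun x (hx : v.r .lo + x < v.r .hi + 1) => by
        rcases (Nat.lt_succ_iff.1 hx).lt_or_eq with hx | hx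
        · exact hv.box x hx
        · change I.pattern (v.r .lo + x) = I.pattern x
          rw [hx, heq, ← hx, Nat.add_sub_cancel_left]
      table := hv.table
      lt := hv.lt
      entry := .inr ⟨by simp [hbound], by simp [hlo], by simpa using by omega⟩ },
      by simp, .inl (by simp)⟩
  · have hend : IsPrefixLen I.pattern I.m (v.r .pos) (v.r .tmp) := by
      refine ⟨by have := hv.hi_le; omega, hbox, fun _ => ?_⟩
      rwa [htmp, show v.r .tmp = v.r .hi - v.r .lo by omega]
    have hrun : prefixExtend.run I.inp v = v.set .bound 0 := by
      simp [prefixExtend, hval, heq]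
    rw [hrun]
    exact ⟨{ hv.congr with
      out := hv.out
      lo_pos := hv.lo_pos
      lo_le := hv.lo_le
      hi_le := hv.hi_le
      box := hv.box
      table := hv.table
      lt := hv.lt
      entry := .inl ⟨by simp, hend⟩ }, by simp, .inr (by simp)⟩

theorem PrefixExtending.isPrefixLen (hv : PrefixExtending π v) (hle : v.r .bound ≤ v.r .hi) :
    IsPrefixLen I.pattern I.m (v.r .pos) (v.r .tmp) := by
  obtain ⟨-, h⟩ | ⟨hbound, hlo, htmp⟩ := hv.entry
  · exact h
  · have := hv.hi_le
    exact ⟨by omega, fun x hx => hlo ▸ hv.box x (by omega), by omega⟩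

theorem PrefixExtending.wp_extendLoop (hv : PrefixExtending π v) (N : ℕ) :
    WP I.inp I.space (whileLt .hi .bound prefixExtend.compile)
      (fun v' N' => (PrefixExtending π v' ∧ v'.r .pos = v.r .pos ∧ v'.r .bound ≤ v'.r .hi) ∧
        N + 80 * (I.m - v'.r .hi) ≤ N') v (N + 80 * (I.m - v.r .hi) + 81) := by
  let f (u : View) := 80 * (I.m - u.r .hi) + 80 * min 1 (u.r .bound - u.r .hi)
  have hloop := WP.whileLt (inp := I.inp) (S := I.space) (x := .hi) (y := .bound)
    (p := prefixExtend.compile) (J := fun u => PrefixExtending π u ∧ u.r .pos = v.r .pos) (N := N)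
    f (fun u N' ⟨hu, hpos⟩ hlt => ?_) ⟨hv, rfl⟩
  · exact (hloop.mono_budget (by simp only [f]; omega)).mono
      fun _ _ ⟨⟨⟨hu, hpos⟩, hle⟩, hN⟩ => ⟨⟨hu, hpos, hle⟩, by simp only [f] at hN; omega⟩
  · obtain ⟨hext, hpos', hprogress⟩ := hu.run_prefixExtend hlt
    have hf : f (prefixExtend.run I.inp u) + 80 ≤ f u := by
      have := (hu.eq_of_lt_bound hlt).1
      have := hext.hi_le
      simp only [f]
      omega
    exact ⟨f (prefixExtend.run I.inp u) + 79, by omega, .cmd _ 79 (by decide) (add_assoc ..).le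
      (hu.safe_prefixExtend hlt) ⟨⟨hext, hpos'.trans hpos⟩, le_rfl⟩⟩

theorem PrefixExtending.run_prefixEnd (hv : PrefixExtending π v) (hle : v.r .bound ≤ v.r .hi) :
    PrefixInv π (prefixEnd.run I.inp v) := by
  have hrun : prefixEnd.run I.inp v =
      (v.store (v.r .pos) (v.r .tmp)).set .pos (v.r .pos + 1) := by
    simp [prefixEnd]
  rw [hrun]
  exact { hv.congr with
    out := hv.out
    lo_pos := hv.lo_pos
    lo_le := by simpa using hv.lo_le.trans (Nat.le_succ _)
    hi_le := hv.hi_le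
    box := hv.box
    table := fun d hd hlt => by
      rcases (Nat.lt_succ_iff.1 hlt).lt_or_eq with hlt | rfl
      · simpa [Function.update_apply, hlt.ne] using hv.table d hd hlt
      · simpa using hv.isPrefixLen hle }

theorem PrefixInv.wp_prefixEntry (hv : PrefixInv π v) (hlt : v.r .pos < I.m) (N : ℕ) :
    WP I.inp I.space prefixEntry (fun v' N' => (PrefixInv π v' ∧ v'.r .pos = v.r .pos + 1) ∧
      N + 80 * (I.m - v'.r .hi) ≤ N') v (N + 80 * (I.m - v.r .hi) + 109) := by
  obtain ⟨hext, hpos, hhi⟩ := hv.run_prefixBegin hlt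
  refine .seq (.cmd (N + 80 * (I.m - v.r .hi) + 88) 21 (by decide) le_rfl
    (hv.safe_prefixBegin hlt) ?_)
  refine .seq (((hext.wp_extendLoop (N + 7)).mono_budget (by omega)).mono ?_)
  rintro u N' ⟨⟨hu, hpos', hle⟩, hN⟩
  have := I.space_ge
  have := I.m_le
  have := I.n_lt
  have := hu.lt
  exact .cmd (N + 80 * (I.m - u.r .hi)) 7 (by decide) (by omega)
    (by simpa [prefixEnd, I.w_ne_zero] using by omega)
    ⟨⟨hu.run_prefixEnd hle, by simp [prefixEnd, hpos', hpos]⟩, by simp [prefixEnd]⟩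

theorem triple_prefixInit : Triple I (fun v => Chosen π v ∧ v.out = []) prefixInit.compile 9
    (PrefixInv π) := by
  refine .cmd (by decide) (fun v _ => ?_) fun v ⟨hv, hout⟩ => ?_
  · have := I.space_ge
    have := I.t_ge
    simpa [prefixInit, I.w_ne_zero] using by omega
  · have hrun : prefixInit.run I.inp v =
        (((v.store 0 I.m).set .lo 1).set .hi 0).set .pos 1 := by
      simp [prefixInit, hv.m]
    rw [hrun]
    exact { hv.congr with
      out := hout
      lo_pos := le_rfl
      lo_le := le_rfl
      hi_le := Nat.zero_le _
      box := fun x (hx : 1 + x < 0) => by omega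
      table := fun d hd (hlt : d < 1) => by
        obtain rfl : d = 0 := by omega
        exact isPrefixLen_zero I.pattern I.m }

theorem triple_prefixPhase : Triple I (fun v => Chosen π v ∧ v.out = []) prefixPhase
    (9 + (190 * I.m + 1)) (fun v => HasPrefixTable π v ∧ v.out = []) := by
  refine triple_prefixInit.seq ?_
  refine (Triple.whileLt (fun v => 110 * (I.m - v.r .pos) + 80 * (I.m - v.r .hi))
    (fun v N hv hlt => ?_) fun v _ => by omega).mono (c := 190 * I.m + 1) fun v ⟨hv, _⟩ => ?_
  · rw [hv.m] at hlt
    refine ⟨110 * (I.m - (v.r .pos + 1)) + 80 * (I.m - v.r .hi) + 109, by omega,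
      ((hv.wp_prefixEntry hlt (N + 110 * (I.m - (v.r .pos + 1)))).mono_budget (by omega)).mono ?_⟩
    rintro u N' ⟨⟨hu, hpos⟩, hN⟩
    exact ⟨hu, by rw [hpos]; omega⟩
  · exact ⟨{ hv.toChosen with table := fun d hd => hv.table d hd (by have := hv.m; omega) }, hv.out⟩

end PrefixTable

/-! ### The anchor -/

/-- An anchor for the distance `q`, short enough to be searched in blocks of `3 * q` characters; in
scan mode it is empty. -/
structure Anchor {w : ℕ} {I : Problem w} (π : Plan I) where
  offset : ℕ
  len : ℕ
  isAnchor : IsAnchor I.pattern I.m π.q offset len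
  len_le : len ≤ 2 * π.q
  scan : π.flag = 0 → offset = 0 ∧ len = 0

section Programs

open Var

/-- The start of the search for a period less than `q` of the first `2 * q` characters of the
pattern. The whole pattern is the anchor if it is shorter than that. -/
def anchorInit : Cmd :=
  offset ::= 0 ;; period ::= 1 ;;
  .ite .eq flag 1
    (.ite .lt m (2 * q) (anchorLen ::= m ;; bound ::= 0) (anchorLen ::= 2 * q ;; bound ::= q))
    (anchorLen ::= 0 ;; bound ::= 0)

/-- The test of one period. If the prefix has it, the search ends, and the anchor ends where the
period breaks, or is the prefix if the whole pattern has the period. -/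
def anchorStep : Cmd :=
  .ite .lt (period + .load period) (2 * q) (period ::= period + 1)
    (bound ::= 0 ;;
      .ite .lt (period + .load period) m
        (offset ::= period + .load period + 1 - 2 * q) (offset ::= 0))

/-- The choice of the anchor. -/
def anchorPhase : Program := .seq anchorInit.compile (whileLt period bound anchorStep.compile)

end Programs

section Anchoring

variable {w : ℕ} {I : Problem w} {π : Plan I} {α : Anchor π} {v v' : View}

theorem HasPrefixTable.congr (hv : HasPrefixTable π v) (hmem : ∀ d < I.m, v'.mem d = v.mem d)
    (h : ∀ x ∈ [Var.m, .n, .t, .b, .k, .q, .flag, .tableSize], v'.r x = v.r x := by simp) :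
    HasPrefixTable π v' where
  toChosen := hv.toChosen.congr h
  table d hd := hmem d hd ▸ hv.table d hd

/-- The variables describe the anchor, and the prefix table is in memory. -/
structure Anchored (α : Anchor π) (v : View) : Prop extends HasPrefixTable π v where
  offset : v.r .offset = α.offset
  anchorLen : v.r .anchorLen = α.len

/-- No positive number less than `period` is a period of the first `2 * q` characters of the
pattern. -/
structure PeriodSearch (π : Plan I) (v : View) : Prop extends HasPrefixTable π v where
  bound : v.r .bound = π.q
  offset : v.r .offset = 0
  anchorLen : v.r .anchorLen = 2 * π.q
  flag_ne : π.flag ≠ 0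
  le_m : 2 * π.q ≤ I.m
  period_pos : 1 ≤ v.r .period
  no_period : ∀ p, 0 < p → p < v.r .period → p + v.mem p < 2 * π.q

/-- The invariant of the search for the anchor. -/
def AnchorInv (π : Plan I) (v : View) : Prop :=
  v.out = [] ∧ (PeriodSearch π v ∨ v.r .bound = 0 ∧ ∃ α : Anchor π, Anchored α v)

theorem Chosen.safe_anchorInit (hv : Chosen π v) : anchorInit.Safe I.inp I.space v := by
  have := π.three_mul_lt
  have := I.four_le
  obtain hflag | hflag := π.flag_cases <;>
    simp [anchorInit, hv.flag, hflag, hv.q, I.w_ne_zero, (show 2 < 2 ^ w by omega),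
      (show 2 * π.q < 2 ^ w by omega)]

theorem HasPrefixTable.run_anchorInit (hv : HasPrefixTable π v) (hout : v.out = []) :
    AnchorInv π (anchorInit.run I.inp v) := by
  obtain hflag | hflag := π.flag_cases
  · have hrun : anchorInit.run I.inp v = (((v.set .offset 0).set .period 1).set .anchorLen
        0).set .bound 0 := by
      simp [anchorInit, hv.flag, hflag]
    have hq : π.q = 1 := π.q_eq_one hflag
    rw [hrun]
    exact ⟨hout, .inr ⟨rfl, ⟨0, 0, hq ▸ isAnchor_one .., Nat.zero_le _, by simp⟩,
      hv.congr fun _ _ => rfl, rfl, rfl⟩⟩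
  · by_cases hm : I.m < 2 * π.q
    · have hrun : anchorInit.run I.inp v = (((v.set .offset 0).set .period 1).set .anchorLen
          I.m).set .bound 0 := by
        simp [anchorInit, hv.flag, hflag, hv.m, hv.q, hm]
      rw [hrun]
      exact ⟨hout, .inr ⟨rfl, ⟨0, I.m, isAnchor_self .., hm.le, by omega⟩,
        hv.congr fun _ _ => rfl, rfl, rfl⟩⟩
    · have hrun : anchorInit.run I.inp v = (((v.set .offset 0).set .period 1).set .anchorLen
          (2 * π.q)).set .bound π.q := by
        simp [anchorInit, hv.flag, hflag, hv.m, hv.q, hm]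
      rw [hrun]
      exact ⟨hout, .inl { hv.congr fun _ _ => rfl with
        bound := rfl
        offset := rfl
        anchorLen := rfl
        flag_ne := by omega
        le_m := not_lt.1 hm
        period_pos := le_rfl
        no_period := fun p hp (hp1 : p < 1) => by omega }⟩

theorem PeriodSearch.safe_anchorStep (hv : PeriodSearch π v) (hlt : v.r .period < π.q) :
    anchorStep.Safe I.inp I.space v := by
  have := π.three_mul_lt
  have := I.four_le
  have := I.m_le
  have := I.n_lt
  have := I.space_ge
  have := hv.le_m
  have hz := (hv.table (v.r .period) (by omega)).le
  by_cases hper : v.r .period + v.mem (v.r .period) < 2 * π.q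
  · simpa [anchorStep, hv.q, hper, I.w_ne_zero] using by omega
  · by_cases hend : v.r .period + v.mem (v.r .period) < I.m
    · simpa [anchorStep, hv.m, hv.q, hper, hend, I.w_ne_zero] using by omega
    · simpa [anchorStep, hv.m, hv.q, hper, hend, I.w_ne_zero] using by omega

theorem PeriodSearch.run_anchorStep (hv : PeriodSearch π v) (hout : v.out = [])
    (hlt : v.r .period < π.q) : AnchorInv π (anchorStep.run I.inp v) ∧
      ((anchorStep.run I.inp v).r .bound = 0 ∨ (anchorStep.run I.inp v).r .bound = π.q ∧
        v.r .period < (anchorStep.run I.inp v).r .period) := by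
  have hpos := hv.period_pos
  have hle := hv.le_m
  have hz := hv.table (v.r .period) (by omega)
  by_cases hper : v.r .period + v.mem (v.r .period) < 2 * π.q
  · have hrun : anchorStep.run I.inp v = v.set .period (v.r .period + 1) := by
      simp [anchorStep, hv.q, hper]
    rw [hrun]
    exact ⟨⟨hout, .inl { hv.congr fun _ _ => rfl with
      bound := hv.bound
      offset := hv.offset
      anchorLen := hv.anchorLen
      flag_ne := hv.flag_ne
      le_m := hle
      period_pos := Nat.le_add_left ..
      no_period := fun p hp hlt => by
        rcases (Nat.lt_succ_iff.1 hlt).lt_or_eq with hlt | rfl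
        · exact hv.no_period p hp hlt
        · exact hper }⟩, .inr ⟨hv.bound, by simp⟩⟩
  · by_cases hend : v.r .period + v.mem (v.r .period) < I.m
    · have hrun : anchorStep.run I.inp v = (v.set .bound 0).set .offset
          (v.r .period + v.mem (v.r .period) + 1 - 2 * π.q) := by
        simp [anchorStep, hv.m, hv.q, hper, hend]
      rw [hrun]
      exact ⟨⟨hout, .inr ⟨rfl, ⟨_, _, isAnchor_of_break hlt hz (not_lt.1 hper) hend, le_rfl,
        fun h => absurd h hv.flag_ne⟩, hv.congr fun _ _ => rfl, rfl, hv.anchorLen⟩⟩, .inl rfl⟩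
    · have hrun : anchorStep.run I.inp v = (v.set .bound 0).set .offset 0 := by
        simp [anchorStep, hv.m, hv.q, hper, hend]
      have hend := hz.le.antisymm (not_lt.1 hend)
      rw [hrun]
      exact ⟨⟨hout, .inr ⟨rfl, ⟨_, _, isAnchor_of_periodic hpos hlt hz (not_lt.1 hper) hend,
        le_rfl, fun h => absurd h hv.flag_ne⟩, hv.congr fun _ _ => rfl, rfl, hv.anchorLen⟩⟩,
        .inl rfl⟩

theorem AnchorInv.exists_anchored (hv : AnchorInv π v) (hle : v.r .bound ≤ v.r .period) :
    ∃ α : Anchor π, Anchored α v := by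
  obtain ⟨-, h | ⟨-, h⟩⟩ := hv
  · have := h.bound
    exact ⟨⟨_, _, isAnchor_of_aperiodic h.le_m h.table fun p hp hlt =>
      h.no_period p hp (by omega), le_rfl, fun h0 => absurd h0 h.flag_ne⟩,
      h.toHasPrefixTable, h.offset, h.anchorLen⟩
  · exact h

theorem triple_anchorPhase : Triple I (fun v => HasPrefixTable π v ∧ v.out = []) anchorPhase
    (30 + (30 * I.t + 1)) (fun v => ∃ α : Anchor π, Anchored α v ∧ v.out = []) := by
  have hinit : Triple I (fun v => HasPrefixTable π v ∧ v.out = []) anchorInit.compile 30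
      (AnchorInv π) :=
    .cmd (by decide) (fun v hv => hv.1.safe_anchorInit) fun v hv => hv.1.run_anchorInit hv.2
  refine hinit.seq ?_
  refine (Triple.whileLt (fun v => 30 * (v.r .bound - v.r .period))
    (fun v N hv hlt => ?_) fun v hv => ?_).mono (c := 30 * I.t + 1) fun v ⟨hv, hle⟩ => ?_
  · have hper : PeriodSearch π v := hv.2.resolve_right fun h => by have := h.1; omega
    have hbound := hper.bound
    obtain ⟨hinv, hprogress⟩ := hper.run_anchorStep hv.1 (hbound ▸ hlt)
    refine ⟨30 * (v.r .bound - v.r .period - 1) + 29, by omega, .cmd _ 29 (by decide)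
      (add_assoc ..).le (hper.safe_anchorStep (hbound ▸ hlt)) ⟨hinv, ?_⟩⟩
    omega
  · have := π.q_le_t
    obtain ⟨-, h | ⟨h, -⟩⟩ := hv
    · have := h.bound
      omega
    · omega
  · obtain ⟨α, hα⟩ := hv.exists_anchored hle
    exact ⟨α, hα, hv.1⟩

end Anchoring

/-! ### The table of shifts -/

section Programs

open Var

/-- The start of the computation of the table of shifts, with the entry for code `0`. -/
def tableInit : Cmd :=
  anchorCode ::= window .pat offset anchorLen ;; code ::= 1 ;;
  .ite .eq flag 1
    (bound ::= tableSize ;; .ite .eq anchorCode 0 (.store m 0) (.store m q))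
    (bound ::= 0)

/-- The computation of one entry of the table of shifts from the entry for the block without its
first character. -/
def tableEntry : Cmd :=
  .ite .eq (code % 1 ≪ (anchorLen * b)) anchorCode (tmp ::= 0)
    (tmp ::= .load (m + code ≫ b) ;; .ite .lt tmp q (tmp ::= tmp + 1) (tmp ::= q))

/-- The computation and storing of one entry of the table of shifts. -/
def tableStep : Cmd := tableEntry ;; .store (m + code) tmp ;; code ::= code + 1

/-- The computation of the table of shifts. -/
def tablePhase : Program := .seq tableInit.compile (whileLt code bound tableStep.compile)

end Programs

section ShiftTable

variable {w : ℕ} {I : Problem w} {π : Plan I} {α : Anchor π} {v v' : View}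

theorem Anchored.congr (hv : Anchored α v) (hmem : ∀ d < I.m, v'.mem d = v.mem d)
    (h : ∀ x ∈ [Var.m, .n, .t, .b, .k, .q, .flag, .tableSize, .offset, .anchorLen],
      v'.r x = v.r x := by simp) : Anchored α v' where
  toHasPrefixTable := hv.toHasPrefixTable.congr hmem (by simp_all)
  offset := (h _ (by simp)).trans hv.offset
  anchorLen := (h _ (by simp)).trans hv.anchorLen

/-- The code of the anchor. -/
def Anchor.code (α : Anchor π) : ℕ := blockCode I.b I.pattern α.offset α.len

/-- The entry of the table of shifts for the block code `c` is `d`. -/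
def Anchor.ShiftIs (α : Anchor π) (c d : ℕ) : Prop := IsShift I.b π.q α.len α.code c d

/-- In table mode the table of shifts starts at address `m`. -/
structure HasShiftTable (α : Anchor π) (v : View) : Prop extends Anchored α v where
  shift : π.flag = 1 → ∀ c < 2 ^ (3 * π.q * I.b), α.ShiftIs c (v.mem (I.m + c))

/-- The invariant of the computation of the table of shifts. -/
structure TableInv (α : Anchor π) (v : View) : Prop extends Anchored α v where
  out : v.out = []
  anchorCode : v.r .anchorCode = α.code
  code_pos : 1 ≤ v.r .code
  bound_le : v.r .bound ≤ I.t
  bound : π.flag = 1 → v.r .bound = 2 ^ (3 * π.q * I.b)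
  bound_scan : π.flag = 0 → v.r .bound = 0
  shift : π.flag = 1 → ∀ c < v.r .code, α.ShiftIs c (v.mem (I.m + c))

theorem Anchor.len_le_k (α : Anchor π) : α.len ≤ I.k := by
  have := α.len_le
  obtain hflag | hflag := π.flag_cases
  · simp [(α.scan hflag).2]
  · have := (π.of_flag_eq_one hflag).1
    omega

theorem Anchor.offset_div_add_one_lt (α : Anchor π) : α.offset / I.k + 1 < 2 ^ w := by
  have := α.isAnchor.le
  have := I.m_le
  have := I.n_lt
  have := I.four_le
  obtain hflag | hflag := π.flag_cases
  · have := (α.scan hflag).1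
    exact I.div_add_one_lt (by omega) (.inl (by omega))
  · have := (π.of_flag_eq_one hflag).1
    have := π.q_pos
    exact I.div_add_one_lt (by omega) (.inr (by omega))

theorem Anchored.safe_tableInit (hv : Anchored α v) : tableInit.Safe I.inp I.space v := by
  have hwindow : (window .pat Var.offset Var.anchorLen).Safe I.inp I.space v := by
    refine safe_window .pat (fun _ => Iff.rfl) hv.toParams trivial trivial
      (hv.anchorLen.trans_le α.len_le_k) ?_
    simpa [hv.offset] using α.offset_div_add_one_lt
  have := I.space_ge
  have := I.t_ge
  have hm : I.m < I.space := by omega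
  by_cases hcode : (window .pat Var.offset Var.anchorLen).val I.inp v = 0 <;>
    by_cases hflag : π.flag = 1 <;>
    simp [tableInit, hwindow, hv.flag, hv.m, hflag, hcode, hm, I.w_ne_zero]

theorem Anchored.tableInv (hv : Anchored α v) (hout : v.out = []) (hcode : v.r .anchorCode = α.code)
    (hone : v.r .code = 1) (hbound : v.r .bound = v.r .tableSize) (hflag : π.flag = 1)
    (hshift : α.ShiftIs 0 (v.mem I.m)) : TableInv α v where
  toAnchored := hv
  out := hout
  anchorCode := hcode
  code_pos := hone.ge
  bound_le := hbound.trans_le ((hv.tableSize hflag).trans_le (π.of_flag_eq_one hflag).2.1)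
  bound _ := hbound.trans (hv.tableSize hflag)
  bound_scan := by omega
  shift _ c hc := by
    obtain rfl : c = 0 := by omega
    exact hshift

theorem Anchored.run_tableInit (hv : Anchored α v) (hout : v.out = []) :
    TableInv α (tableInit.run I.inp v) := by
  have hcode : (window .pat Var.offset Var.anchorLen).val I.inp v = α.code := by
    rw [val_window_pat hv.toParams (c := Var.anchorLen) (hv.anchorLen.trans_le α.len_le_k)]
    simp [hv.offset, hv.anchorLen, Anchor.code]
  let u : View := (v.set .anchorCode α.code).set .code 1
  obtain hflag | hflag := π.flag_cases
  · have hrun : tableInit.run I.inp v = u.set .bound 0 := by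
      simp [tableInit, hcode, hv.flag, hflag, u]
    rw [hrun]
    exact { hv.congr fun _ _ => rfl with
      out := hout
      anchorCode := rfl
      code_pos := le_rfl
      bound_le := Nat.zero_le _
      bound := by omega
      bound_scan := fun _ => rfl
      shift := by omega }
  · let z := if α.code = 0 then 0 else π.q
    have hz : α.ShiftIs 0 z := by
      simp only [z]
      split_ifs with h
      · exact .of_eq (by simp [h])
      · exact isShift_zero h
    have hrun : tableInit.run I.inp v = (u.set .bound (v.r .tableSize)).store I.m z := by
      by_cases h : α.code = 0 <;> simp [tableInit, hcode, hv.flag, hv.m, hv.q, hflag, h, u, z]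
    rw [hrun]
    exact (hv.congr (fun d hd => by simp [u, hd.ne]) (by simp [u])).tableInv hout rfl rfl rfl hflag
      (by simpa using hz)

theorem TableInv.of_lt_bound (hv : TableInv α v) (hlt : v.r .code < v.r .bound) :
    π.flag = 1 ∧ v.r .code < 2 ^ (3 * π.q * I.b) := by
  obtain hflag | hflag := π.flag_cases
  · simp [hv.bound_scan hflag] at hlt
  · exact ⟨hflag, hv.bound hflag ▸ hlt⟩

theorem Anchor.two_pow_len_lt (α : Anchor π) (hflag : π.flag = 1) : 2 ^ (α.len * I.b) < 2 ^ w := by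
  have := α.len_le
  calc 2 ^ (α.len * I.b) ≤ 2 ^ (3 * π.q * I.b) :=
        Nat.pow_le_pow_right two_pos (Nat.mul_le_mul_right _ (by omega))
    _ ≤ I.t := (π.of_flag_eq_one hflag).2.1
    _ < 2 ^ w := I.t_lt

theorem TableInv.run_tableEntry (hv : TableInv α v) (hlt : v.r .code < v.r .bound) :
    ∃ z, tableEntry.run I.inp v = v.set .tmp z ∧ α.ShiftIs (v.r .code) z := by
  obtain ⟨hflag, -⟩ := hv.of_lt_bound hlt
  have hanchor : 2 ^ (α.len * I.b) % 2 ^ w = 2 ^ (α.len * I.b) :=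
    Nat.mod_eq_of_lt (α.two_pow_len_lt hflag)
  have hpos := hv.code_pos
  have hdiv : v.r .code / 2 ^ I.b < v.r .code :=
    Nat.div_lt_self hpos (Nat.one_lt_two_pow (by have := I.b_pos; omega))
  have hshift := hv.shift hflag _ hdiv
  by_cases h : v.r .code % 2 ^ (α.len * I.b) = α.code
  · exact ⟨0, by simp [tableEntry, hv.anchorLen, hv.b, hanchor, hv.anchorCode, h], .of_eq h⟩
  · refine ⟨_, ?_, hshift.step h⟩
    split_ifs with hq <;>
      simp [tableEntry, hv.anchorLen, hv.b, hv.q, hv.m, hanchor, hv.anchorCode, h, hq]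

theorem TableInv.safe_tableEntry (hv : TableInv α v) (hlt : v.r .code < v.r .bound) :
    tableEntry.Safe I.inp I.space v := by
  obtain ⟨hflag, -⟩ := hv.of_lt_bound hlt
  obtain ⟨-, -, _, _⟩ := π.of_flag_eq_one hflag
  have := hv.bound_le
  have := I.space_ge
  have := I.n_lt
  have hlen := I.mul_b_lt α.len_le_k
  have hdiv := Nat.div_le_self (v.r .code) (2 ^ I.b)
  have hload : I.m + v.r .code / 2 ^ I.b < 2 ^ w ∧ I.m + v.r .code / 2 ^ I.b < I.space := by omega
  by_cases h : v.r .code % (2 ^ (α.len * I.b) % 2 ^ w) = α.code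
  · simp [tableEntry, hv.anchorLen, hv.b, hv.anchorCode, h, hlen, I.w_ne_zero]
  · by_cases hq : v.mem (I.m + v.r .code / 2 ^ I.b) < π.q
    · have htmp : v.mem (I.m + v.r .code / 2 ^ I.b) + 1 < 2 ^ w := by
        have := π.three_mul_lt
        omega
      simp [tableEntry, hv.anchorLen, hv.b, hv.q, hv.m, hv.anchorCode, h, hlen, hload, hq, htmp,
        I.w_ne_zero]
    · simp [tableEntry, hv.anchorLen, hv.b, hv.q, hv.m, hv.anchorCode, h, hlen, hload, hq,
        I.w_ne_zero]

theorem TableInv.safe_tableStep (hv : TableInv α v) (hlt : v.r .code < v.r .bound) :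
    tableStep.Safe I.inp I.space v := by
  obtain ⟨hflag, -⟩ := hv.of_lt_bound hlt
  obtain ⟨-, -, _, _⟩ := π.of_flag_eq_one hflag
  obtain ⟨z, hentry, -⟩ := hv.run_tableEntry hlt
  have := hv.bound_le
  have := I.space_ge
  have := I.n_lt
  have hadd : I.m + v.r .code < 2 ^ w ∧ I.m + v.r .code < I.space ∧ v.r .code + 1 < 2 ^ w := by
    omega
  simp [tableStep, hentry, hv.safe_tableEntry hlt, hv.m, hadd, I.w_ne_zero]

theorem TableInv.run_tableStep (hv : TableInv α v) (hlt : v.r .code < v.r .bound) :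
    TableInv α (tableStep.run I.inp v) ∧
      (tableStep.run I.inp v).r .bound = v.r .bound ∧
      (tableStep.run I.inp v).r .code = v.r .code + 1 := by
  obtain ⟨z, hentry, hz⟩ := hv.run_tableEntry hlt
  have hrun : tableStep.run I.inp v =
      ((v.set .tmp z).store (I.m + v.r .code) z).set .code (v.r .code + 1) := by
    simp [tableStep, hentry, hv.m]
  rw [hrun]
  refine ⟨{ hv.congr fun d hd => ?_ with
    out := hv.out
    anchorCode := hv.anchorCode
    code_pos := Nat.le_add_left _ _
    bound_le := hv.bound_le
    bound := hv.bound
    bound_scan := hv.bound_scan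
    shift := fun hflag c hc => ?_ }, rfl, rfl⟩
  · simp [show d ≠ I.m + v.r .code by omega]
  · obtain hc | rfl := (Nat.lt_succ_iff.1 hc).lt_or_eq
    · simpa [Function.update_apply, hc.ne] using hv.shift hflag c hc
    · simpa using hz

theorem triple_tablePhase : Triple I (fun v => Anchored α v ∧ v.out = []) tablePhase
    (50 + (50 * I.t + 1)) (fun v => HasShiftTable α v ∧ v.out = []) := by
  refine (Triple.cmd (by decide) (fun v hv => hv.1.safe_tableInit)
    fun v hv => hv.1.run_tableInit hv.2).seq ?_
  refine (Triple.whileLt (fun v => 50 * (v.r .bound - v.r .code)) (fun v N hv hlt => ?_)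
    fun v hv => ?_).mono (c := 50 * I.t + 1) fun v ⟨hv, hle⟩ => ?_
  · obtain ⟨hinv, hbound, hcode⟩ := hv.run_tableStep hlt
    exact ⟨50 * (v.r .bound - (v.r .code + 1)) + 49, by omega, .cmd _ 49 (by decide)
      (add_assoc ..).le (hv.safe_tableStep hlt) ⟨hinv, by rw [hbound, hcode]⟩⟩
  · have := hv.bound_le
    omega
  · exact ⟨{ hv.toAnchored with
      shift := fun hflag c hc => hv.shift hflag c (hc.trans_le (hv.bound hflag ▸ hle)) }, hv.out⟩

end ShiftTable

/-! ### Occurrences -/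

section Occurrences

variable {w : ℕ} {I : Problem w} {π : Plan I} {α : Anchor π}

/-- The pattern occurs in the text at position `s`. -/
def Problem.Occurs (I : Problem w) (s : ℕ) : Prop := s + I.m ≤ I.n ∧ MatchAt I.text I.pattern I.m s

/-- `out` lists the occurrences before position `x`, each of them once. -/
def Problem.Reported (I : Problem w) (x : ℕ) (out : List ℕ) : Prop :=
  out.Nodup ∧ ∀ i, i ∈ out ↔ I.Occurs i ∧ i < x

/-- The number of occurrences from position `x` on. -/
noncomputable def Problem.occCount (I : Problem w) (x : ℕ) : ℕ := {i | x ≤ i ∧ I.Occurs i}.ncard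

theorem Problem.reported_nil (I : Problem w) : I.Reported 0 [] := by
  simp [Problem.Reported]

theorem Problem.Reported.mono {x y : ℕ} {out : List ℕ} (h : I.Reported x out) (hxy : x ≤ y)
    (hno : ∀ i, x ≤ i → i < y → ¬ I.Occurs i) : I.Reported y out := by
  refine ⟨h.1, fun i => (h.2 i).trans (and_congr_right fun hi => ?_)⟩
  have := hno i
  grind

theorem Problem.Reported.of_sub_lt {x : ℕ} {out : List ℕ} (h : I.Reported x out)
    (hx : I.n - I.m < x) : I.Reported (I.n + 1) out := by
  refine ⟨h.1, fun i => (h.2 i).trans (and_congr_right fun hi => ?_)⟩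
  have := hi.1
  omega

theorem Problem.Reported.snoc {x : ℕ} {out : List ℕ} (h : I.Reported x out) (hx : I.Occurs x) :
    I.Reported (x + 1) (out ++ [x]) := by
  refine ⟨List.nodup_append.2 ⟨h.1, List.nodup_singleton x, fun i hi => ?_⟩, fun i => ?_⟩
  · have := ((h.2 i).1 hi).2
    simpa using this.ne
  · rw [List.mem_append, h.2, List.mem_singleton]
    grind

theorem Problem.finite_setOf_occurs (I : Problem w) (x : ℕ) : {i | x ≤ i ∧ I.Occurs i}.Finite :=
  (Set.finite_Iic I.n).subset fun i hi => by
    have := hi.2.1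
    exact Set.mem_Iic.2 (by omega)

theorem Problem.occCount_antitone (I : Problem w) : Antitone I.occCount := fun x _ h =>
  Set.ncard_le_ncard (fun _ hi => ⟨h.trans hi.1, hi.2⟩) (I.finite_setOf_occurs x)

theorem Problem.occCount_succ_lt {s : ℕ} (hs : I.Occurs s) : I.occCount (s + 1) < I.occCount s := by
  refine Set.ncard_lt_ncard ⟨fun i hi => ⟨by have := hi.1; omega, hi.2⟩, fun h => ?_⟩
    (I.finite_setOf_occurs s)
  have := (h (⟨le_rfl, hs⟩ : s ∈ {i | s ≤ i ∧ I.Occurs i})).1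
  omega

/-- The text agrees with the anchor at the place that the anchor has in an occurrence at `s`. -/
def Anchor.FoundAt (α : Anchor π) (s : ℕ) : Prop :=
  ∀ j < α.len, I.text (s + α.offset + j) = I.pattern (α.offset + j)

theorem Anchor.foundAt_of_occurs (α : Anchor π) {s : ℕ} (h : I.Occurs s) : α.FoundAt s := by
  intro j hj
  have := α.isAnchor.le
  rw [add_assoc]
  exact h.2 _ (by omega)

theorem Anchor.not_occurs_of_foundAt {s y : ℕ} (hs : α.FoundAt s)
    (hno : ¬ MatchAt I.text I.pattern I.m s) (hsy : s ≤ y) (hy : y < s + π.q) : ¬ I.Occurs y := by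
  obtain ⟨d, rfl⟩ := Nat.exists_eq_add_of_le hsy
  obtain rfl | hd := d.eq_zero_or_pos
  · exact fun h => hno h.2
  · exact fun h => α.isAnchor.skip I.text s hs hno d hd (by omega) h.2

theorem Anchor.code_eq_iff (α : Anchor π) (x : ℕ) {d : ℕ} (hd : d ≤ π.q) :
    blockCode I.b I.text (x + α.offset) (3 * π.q) / 2 ^ (d * I.b) % 2 ^ (α.len * I.b) = α.code ↔
      α.FoundAt (x + d) := by
  have := α.len_le
  rw [blockCode_div I.text_lt _ (by omega), blockCode_mod I.text_lt _ (by omega), Anchor.code,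
    blockCode_eq_iff I.text_lt I.pattern_lt, Anchor.FoundAt, add_right_comm]

theorem Anchor.ShiftIs.not_occurs {x d : ℕ}
    (h : α.ShiftIs (blockCode I.b I.text (x + α.offset) (3 * π.q)) d) {y : ℕ} (hxy : x ≤ y)
    (hy : y < x + d) : ¬ I.Occurs y := by
  obtain ⟨e, rfl⟩ := Nat.exists_eq_add_of_le hxy
  intro hocc
  have := h.le
  exact h.ne e (by omega) ((α.code_eq_iff x (by omega)).2 (α.foundAt_of_occurs hocc))

theorem Anchor.ShiftIs.foundAt {x d : ℕ}
    (h : α.ShiftIs (blockCode I.b I.text (x + α.offset) (3 * π.q)) d) (hd : d < π.q) :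
    α.FoundAt (x + d) :=
  (α.code_eq_iff x hd.le).1 (h.eq hd)

end Occurrences

/-! ### The search -/

section Programs

open Var

/-- The start of the search. -/
def searchInit : Cmd :=
  pos ::= 0 ;; lo ::= 0 ;; hi ::= 0 ;; done ::= 0 ;; last ::= n - m ;; one ::= 1

/-- Looking up the shift from the first undecided position to the next candidate. -/
def searchFind : Cmd :=
  .ite .eq flag 1 (shift ::= .load (m + window .txt (pos + offset) (3 * q))) (shift ::= 0)

/-- The start of the comparison of the pattern with the text at the candidate, given the end of the
stretch of text that is known to match. -/
def searchAccept (e : Expr) : Cmd := hi ::= e ;; lo ::= cand ;; bound ::= cand + m ;; alive ::= 1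

/-- The test of a candidate. If it lies in the stretch of text that is known to match a prefix of
the pattern, the prefix table tells whether the pattern matches up to the end of that stretch. -/
def searchTest : Cmd :=
  .ite .lt cand hi
    (.ite .lt (.load (cand - lo)) (hi - cand) (alive ::= 0) (searchAccept hi)) (searchAccept cand)

/-- The advance over the shift, without a candidate. -/
def searchSkip : Cmd := cand ::= pos ;; step ::= shift

/-- The choice of the next candidate. -/
def searchBegin : Cmd :=
  bound ::= 0 ;; alive ::= 0 ;;
  .ite .lt shift q
    (.ite .lt (last - pos) shift searchSkip (cand ::= pos + shift ;; step ::= q ;; searchTest))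
    searchSkip

/-- The length of the next block of the comparison. -/
def searchBlock : Cmd := tmp ::= bound - hi ;; .ite .lt q tmp (tmp ::= q) (tmp ::= tmp)

/-- The comparison of the next block of at most `q` characters. -/
def searchCompare : Cmd :=
  searchBlock ;;
  .ite .eq (window .txt hi tmp) (window .pat (hi - lo) tmp)
    (hi ::= hi + tmp) (bound ::= 0 ;; alive ::= 0)

/-- The report of an occurrence. -/
def searchReport : Cmd := .ite .eq alive 1 (.report cand ;; step ::= 1) (alive ::= 0)

/-- The advance of the first undecided position. -/
def searchAdvance : Cmd := .ite .lt (last - cand) step (done ::= 1) (pos ::= cand + step)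

/-- One round of the search. -/
def searchRound : Program :=
  .seq (.seq searchFind.compile searchBegin.compile)
    (.seq (whileLt hi bound searchCompare.compile)
      (.seq searchReport.compile searchAdvance.compile))

/-- The search. -/
def searchPhase : Program := .seq searchInit.compile (whileLt done one searchRound)

end Programs

section Search

variable {w : ℕ} {I : Problem w} {π : Plan I} {α : Anchor π} {v v' : View}

/-- What the search uses of the preprocessing. -/
structure Ready (α : Anchor π) (v : View) : Prop extends HasShiftTable α v where
  last : v.r .last = I.n - I.m
  one : v.r .one = 1

theorem Ready.congr (hv : Ready α v) (hmem : v'.mem = v.mem := by rfl)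
    (h : ∀ x ∈ [Var.m, .n, .t, .b, .k, .q, .flag, .tableSize, .offset, .anchorLen, .last, .one],
      v'.r x = v.r x := by simp) : Ready α v' where
  toAnchored := hv.toAnchored.congr (fun _ _ => by rw [hmem]) (by simp_all)
  shift hflag c hc := hmem ▸ hv.shift hflag c hc
  last := (h _ (by simp)).trans hv.last
  one := (h _ (by simp)).trans hv.one

/-- While the search goes on, the stretch of text from `lo` to `hi` matches a prefix of the
pattern. -/
structure Searching (α : Anchor π) (v : View) : Prop extends Ready α v where
  done : v.r .done = 0
  lo_le_hi : v.r .lo ≤ v.r .hi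
  hi_le_lo_add : v.r .hi ≤ v.r .lo + I.m
  hi_le_n : v.r .hi ≤ I.n
  box : ∀ x, v.r .lo + x < v.r .hi → I.text (v.r .lo + x) = I.pattern x

theorem Searching.congr (hv : Searching α v) (hmem : v'.mem = v.mem := by rfl)
    (h : ∀ x ∈ [Var.m, .n, .t, .b, .k, .q, .flag, .tableSize, .offset, .anchorLen, .last, .one,
      .done, .lo, .hi], v'.r x = v.r x := by simp) : Searching α v' := by
  have hlo : v'.r .lo = v.r .lo := h _ (by simp)
  have hhi : v'.r .hi = v.r .hi := h _ (by simp)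
  exact { hv.toReady.congr hmem (by simp_all) with
    done := (h _ (by simp)).trans hv.done
    lo_le_hi := by rw [hlo, hhi]; exact hv.lo_le_hi
    hi_le_lo_add := by rw [hlo, hhi]; exact hv.hi_le_lo_add
    hi_le_n := by rw [hhi]; exact hv.hi_le_n
    box := by rw [hlo, hhi]; exact hv.box }

/-- The invariant of the rounds of the search: the occurrences before `pos` have been reported. -/
structure RoundInv (α : Anchor π) (v : View) : Prop extends Searching α v where
  lo_le : v.r .lo ≤ v.r .pos
  pos_le : v.r .pos + I.m ≤ I.n
  reported : I.Reported (v.r .pos) v.out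

/-- There is no occurrence from `pos` up to the position at distance `shift`, where the anchor has
been found if it is at distance less than `q`. -/
structure Found (α : Anchor π) (v : View) : Prop extends RoundInv α v where
  not_occurs : ∀ y, v.r .pos ≤ y → y < v.r .pos + v.r .shift → ¬ I.Occurs y
  foundAt : v.r .shift < π.q → α.FoundAt (v.r .pos + v.r .shift)

/-- There is no occurrence from `pos` up to the position at distance `step` from the candidate. -/
structure Rejected (π : Plan I) (v : View) : Prop where
  alive : v.r .alive = 0
  bound : v.r .bound = 0
  not_occurs : ∀ y, v.r .pos ≤ y → y < v.r .cand + v.r .step → ¬ I.Occurs y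
  progress : π.q ≤ v.r .step ∨ I.n - I.m < v.r .cand + v.r .step

/-- The candidate may be an occurrence, and there is none before it. -/
structure Matching (α : Anchor π) (v : View) : Prop where
  alive : v.r .alive = 1
  bound : v.r .bound = v.r .cand + I.m
  step : v.r .step = π.q
  lo : v.r .lo = v.r .cand
  not_occurs : ∀ y, v.r .pos ≤ y → y < v.r .cand → ¬ I.Occurs y
  foundAt : α.FoundAt (v.r .cand)

/-- The search is at a candidate, and the occurrences before `pos` have been reported. -/
structure Candidate (α : Anchor π) (v : View) : Prop extends Searching α v where
  lo_le : v.r .lo ≤ v.r .cand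
  pos_le : v.r .pos ≤ v.r .cand
  cand_le : v.r .cand + I.m ≤ I.n
  reported : I.Reported (v.r .pos) v.out

/-- The candidate has not been tested yet. -/
structure Untested (α : Anchor π) (v : View) : Prop extends Candidate α v where
  bound : v.r .bound = 0
  step : v.r .step = π.q
  not_occurs : ∀ y, v.r .pos ≤ y → y < v.r .cand → ¬ I.Occurs y
  foundAt : α.FoundAt (v.r .cand)

/-- The invariant of the examination of a candidate. -/
structure Examine (α : Anchor π) (v : View) : Prop extends Candidate α v where
  status : Rejected π v ∨ Matching α v

/-- A bound on the number of rounds of the search from position `x` on: a round advances by at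
least the block length or reports an occurrence, except for the last one. -/
noncomputable def Plan.rounds (π : Plan I) (x : ℕ) : ℕ := (I.n - I.m - x) / π.q + I.occCount x + 1

/-- The occurrences before the position at distance `step` from the candidate have been reported, in
a round that started at position `x`. -/
structure Advancing (α : Anchor π) (x : ℕ) (v : View) : Prop extends Searching α v where
  lo_le : v.r .lo ≤ v.r .cand
  cand_le : v.r .cand + I.m ≤ I.n
  reported : I.Reported (v.r .cand + v.r .step) v.out
  progress : v.r .cand + v.r .step ≤ I.n - I.m →
    π.rounds (v.r .cand + v.r .step) < π.rounds x

/-- The invariant of the search. -/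
def SearchInv (α : Anchor π) (v : View) : Prop :=
  RoundInv α v ∨ v.r .done = 1 ∧ v.r .one = 1 ∧ I.Reported (I.n + 1) v.out

/-- A bound on the time of the rest of the search. -/
noncomputable def Plan.searchTime (π : Plan I) (v : View) : ℕ :=
  (1 - v.r .done) * (300 * π.rounds (v.r .pos)) + 100 * ((I.n - v.r .hi) / π.q)

theorem HasShiftTable.run_searchInit (hv : HasShiftTable α v) (hout : v.out = []) :
    RoundInv α (searchInit.run I.inp v) := by
  have hrun : searchInit.run I.inp v =
      (((((v.set .pos 0).set .lo 0).set .hi 0).set .done 0).set .last (I.n - I.m)).set .one 1 := by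
    simp [searchInit, hv.m, hv.n]
  rw [hrun]
  exact { hv.toAnchored.congr fun _ _ => rfl with
    shift := hv.shift
    last := rfl
    one := rfl
    done := rfl
    lo_le_hi := le_rfl
    hi_le_lo_add := Nat.zero_le _
    hi_le_n := Nat.zero_le _
    box := fun x (hx : 0 + x < 0) => by omega
    lo_le := le_rfl
    pos_le := (Nat.zero_add _).trans_le I.m_le
    reported := by simpa [hout] using I.reported_nil }

/-- The block code looked up in table mode. -/
theorem RoundInv.val_window (hv : RoundInv α v) (hflag : π.flag = 1) :
    (window .txt (Var.pos + Var.offset) (3 * Var.q)).val I.inp v =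
      blockCode I.b I.text (v.r .pos + α.offset) (3 * π.q) := by
  rw [val_window_txt hv.toParams (by simpa [hv.q] using (π.of_flag_eq_one hflag).1)]
  simp [hv.q, hv.offset]

theorem RoundInv.safe_searchFind (hv : RoundInv α v) : searchFind.Safe I.inp I.space v := by
  have h4 := I.four_le
  have hlt := blockCode_lt I.text_lt (v.r .pos + α.offset) (3 * π.q)
  obtain hflag | hflag := π.flag_cases
  · simp [searchFind, hv.flag, hflag, I.w_ne_zero]
  · obtain ⟨hk, _, _, _⟩ := π.of_flag_eq_one hflag
    have := α.isAnchor.le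
    have := hv.pos_le
    have := I.n_lt
    have := π.q_pos
    have := I.space_ge
    have hpos : v.r .pos + α.offset < 2 ^ w := by omega
    have hthree : 3 < 2 ^ w := by omega
    have hwindow : (window .txt (Var.pos + Var.offset) (3 * Var.q)).Safe I.inp I.space v := by
      refine safe_window .txt (fun _ => Iff.rfl) hv.toParams ?_ ?_ ?_ ?_
      · simpa [hv.offset] using hpos
      · simpa [hv.q, hthree] using π.three_mul_lt
      · simpa [hv.q] using hk
      · simpa [hv.offset] using I.div_add_one_lt hpos (.inr (by omega))
    simpa [searchFind, hv.flag, hflag, hwindow, hv.val_window hflag, hv.m, I.w_ne_zero]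
      using by omega

theorem RoundInv.run_searchFind (hv : RoundInv α v) : Found α (searchFind.run I.inp v) ∧
    (searchFind.run I.inp v).r .pos = v.r .pos ∧ (searchFind.run I.inp v).r .hi = v.r .hi := by
  have hround : ∀ d, RoundInv α (v.set .shift d) := fun d => { hv.toSearching.congr with
    lo_le := hv.lo_le
    pos_le := hv.pos_le
    reported := hv.reported }
  obtain hflag | hflag := π.flag_cases
  · have hrun : searchFind.run I.inp v = v.set .shift 0 := by simp [searchFind, hv.flag, hflag]
    rw [hrun]
    exact ⟨{ hround 0 with
      not_occurs := fun y (hy : v.r .pos ≤ y) (hy' : y < v.r .pos + 0) => by omega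
      foundAt := fun _ => by simp [Anchor.FoundAt, (α.scan hflag).2] }, rfl, rfl⟩
  · let c := blockCode I.b I.text (v.r .pos + α.offset) (3 * π.q)
    have hshift : α.ShiftIs c (v.mem (I.m + c)) := hv.shift hflag c (blockCode_lt I.text_lt _ _)
    have hrun : searchFind.run I.inp v = v.set .shift (v.mem (I.m + c)) := by
      simp [searchFind, hv.flag, hflag, hv.m, hv.val_window hflag, c]
    rw [hrun]
    exact ⟨{ hround _ with
      not_occurs := fun y hy hy' => hshift.not_occurs hy hy'
      foundAt := fun hd => hshift.foundAt hd }, rfl, rfl⟩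

theorem Found.examine_of_le (hv : Found α v)
    (h : π.q ≤ v.r .shift ∨ I.n - I.m < v.r .pos + v.r .shift) :
    Examine α ((((v.set .bound 0).set .alive 0).set .cand (v.r .pos)).set .step (v.r .shift)) :=
  { hv.toSearching.congr with
    lo_le := hv.lo_le
    pos_le := le_rfl
    cand_le := hv.pos_le
    reported := hv.reported
    status := .inl ⟨rfl, rfl, hv.not_occurs, h⟩ }

theorem Found.untested (hv : Found α v) (hshift : v.r .shift < π.q)
    (hle : v.r .pos + v.r .shift ≤ I.n - I.m) :
    Untested α ((((v.set .bound 0).set .alive 0).set .cand (v.r .pos + v.r .shift)).set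
      .step π.q) :=
  { hv.toSearching.congr with
    lo_le := hv.lo_le.trans (Nat.le_add_right _ _)
    pos_le := Nat.le_add_right _ _
    cand_le := by have := I.m_le; simpa using by omega
    reported := hv.reported
    bound := rfl
    step := rfl
    not_occurs := hv.not_occurs
    foundAt := hv.foundAt hshift }

theorem Untested.examine_of_not_occurs (hv : Untested α v)
    (hno : ¬ MatchAt I.text I.pattern I.m (v.r .cand)) : Examine α (v.set .alive 0) :=
  { hv.toSearching.congr with
    lo_le := hv.lo_le
    pos_le := hv.pos_le
    cand_le := hv.cand_le
    reported := hv.reported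
    status := .inl ⟨rfl, hv.bound, fun y hy (hlt : y < v.r .cand + v.r .step) => by
      rw [hv.step] at hlt
      obtain hy' | hy' := lt_or_ge y (v.r .cand)
      · exact hv.not_occurs y hy hy'
      · exact Anchor.not_occurs_of_foundAt hv.foundAt hno hy' hlt, .inl hv.step.ge⟩ }

theorem Untested.examine_of_box (hv : Untested α v) {h : ℕ} (hle : v.r .cand ≤ h)
    (hm : h ≤ v.r .cand + I.m)
    (hbox : ∀ x, v.r .cand + x < h → I.text (v.r .cand + x) = I.pattern x) :
    Examine α ((((v.set .hi h).set .lo (v.r .cand)).set .bound (v.r .cand + I.m)).set .alive 1) :=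
  { hv.toReady.congr with
    done := hv.done
    lo_le_hi := hle
    hi_le_lo_add := hm
    hi_le_n := hm.trans hv.cand_le
    box := hbox
    lo_le := le_rfl
    pos_le := hv.pos_le
    cand_le := hv.cand_le
    reported := hv.reported
    status := .inr ⟨rfl, rfl, hv.step, rfl, hv.not_occurs, hv.foundAt⟩ }

theorem Untested.run_searchTest (hv : Untested α v) : Examine α (searchTest.run I.inp v) ∧
    (searchTest.run I.inp v).r .pos = v.r .pos ∧ v.r .hi ≤ (searchTest.run I.inp v).r .hi := by
  have hlo := hv.lo_le
  have hhi := hv.hi_le_lo_add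
  by_cases hlt : v.r .cand < v.r .hi
  · have hz := hv.table (v.r .cand - v.r .lo) (by omega)
    by_cases hmem : v.mem (v.r .cand - v.r .lo) < v.r .hi - v.r .cand
    · have hrun : searchTest.run I.inp v = v.set .alive 0 := by simp [searchTest, hlt, hmem]
      rw [hrun]
      exact ⟨hv.examine_of_not_occurs (not_matchAt_of_box hlo hhi hv.box hz hmem), rfl, le_rfl⟩
    · have hrun : searchTest.run I.inp v =
          (((v.set .hi (v.r .hi)).set .lo (v.r .cand)).set .bound (v.r .cand + I.m)).set
            .alive 1 := by
        simp [searchTest, searchAccept, hlt, hmem, hv.m]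
      rw [hrun]
      exact ⟨hv.examine_of_box hlt.le (by omega) (box_shift hlo hv.box hz (not_lt.1 hmem)), rfl,
        le_rfl⟩
  · have hrun : searchTest.run I.inp v =
        (((v.set .hi (v.r .cand)).set .lo (v.r .cand)).set .bound (v.r .cand + I.m)).set
          .alive 1 := by
      simp [searchTest, searchAccept, hlt, hv.m]
    rw [hrun]
    exact ⟨hv.examine_of_box le_rfl (by omega) (fun x hx => by omega), rfl, not_lt.1 hlt⟩

theorem Untested.safe_searchTest (hv : Untested α v) : searchTest.Safe I.inp I.space v := by
  have := hv.lo_le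
  have := hv.hi_le_lo_add
  have := hv.cand_le
  have := I.n_lt
  have := I.space_ge
  by_cases hlt : v.r .cand < v.r .hi
  · by_cases hmem : v.mem (v.r .cand - v.r .lo) < v.r .hi - v.r .cand
    · simpa [searchTest, hlt, hmem] using by omega
    · simpa [searchTest, searchAccept, hlt, hmem, hv.m, I.w_ne_zero] using by omega
  · simpa [searchTest, searchAccept, hlt, hv.m, I.w_ne_zero] using by omega

theorem Found.run_searchBegin (hv : Found α v) : Examine α (searchBegin.run I.inp v) ∧
    (searchBegin.run I.inp v).r .pos = v.r .pos ∧ v.r .hi ≤ (searchBegin.run I.inp v).r .hi := by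
  have hpos := hv.pos_le
  by_cases hshift : v.r .shift < π.q ∧ v.r .pos + v.r .shift ≤ I.n - I.m
  · have hrun : searchBegin.run I.inp v = searchTest.run I.inp
        ((((v.set .bound 0).set .alive 0).set .cand (v.r .pos + v.r .shift)).set .step π.q) := by
      have : ¬ I.n - I.m - v.r .pos < v.r .shift := by omega
      simp [searchBegin, hv.q, hv.last, hshift, this]
    rw [hrun]
    exact (hv.untested hshift.1 hshift.2).run_searchTest
  · have hrun : searchBegin.run I.inp v =
        (((v.set .bound 0).set .alive 0).set .cand (v.r .pos)).set .step (v.r .shift) := by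
      by_cases hlt : v.r .shift < π.q
      · have : I.n - I.m - v.r .pos < v.r .shift := by omega
        simp [searchBegin, searchSkip, hv.q, hv.last, hlt, this]
      · simp [searchBegin, searchSkip, hv.q, hlt]
    rw [hrun]
    exact ⟨hv.examine_of_le (by omega), rfl, le_rfl⟩

theorem Found.safe_searchBegin (hv : Found α v) : searchBegin.Safe I.inp I.space v := by
  have hpos := hv.pos_le
  have hm := I.m_le
  have hn := I.n_lt
  have hle : v.r .pos ≤ I.n - I.m := by omega
  by_cases hshift : v.r .shift < π.q ∧ v.r .pos + v.r .shift ≤ I.n - I.m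
  · have hlt : ¬ I.n - I.m - v.r .pos < v.r .shift := by omega
    have hadd : v.r .pos + v.r .shift < 2 ^ w := by omega
    simpa [searchBegin, hv.q, hv.last, hshift, hlt, hle, hadd, I.w_ne_zero] using
      (hv.untested hshift.1 hshift.2).safe_searchTest
  · by_cases hlt : v.r .shift < π.q
    · have : I.n - I.m - v.r .pos < v.r .shift := by omega
      simp [searchBegin, searchSkip, hv.q, hv.last, hlt, this, hle]
    · simp [searchBegin, searchSkip, hv.q, hlt]

theorem Examine.matching (hv : Examine α v) (hlt : v.r .hi < v.r .bound) : Matching α v :=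
  hv.status.resolve_left fun h => by have := h.bound; omega

theorem Chosen.run_searchBlock (hv : Chosen π v) :
    searchBlock.run I.inp v = v.set .tmp (min π.q (v.r .bound - v.r .hi)) := by
  obtain h | h := lt_or_ge π.q (v.r .bound - v.r .hi)
  · simp [searchBlock, hv.q, h, h.le]
  · simp [searchBlock, hv.q, h, h.not_gt]

theorem Examine.extend (hv : Examine α v) (hm : Matching α v) {c : ℕ}
    (hc : v.r .hi + c ≤ v.r .bound)
    (heq : ∀ x < c, I.text (v.r .hi + x) = I.pattern (v.r .hi - v.r .lo + x)) :
    Examine α ((v.set .tmp c).set .hi (v.r .hi + c)) := by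
  have hlo := hv.lo_le_hi
  have hcand := hv.cand_le
  have hbound := hm.bound
  exact { hv.toReady.congr with
    done := hv.done
    lo_le_hi := hlo.trans (Nat.le_add_right _ _)
    hi_le_lo_add := hc.trans (hm.lo ▸ hbound.le)
    hi_le_n := hc.trans (hbound.trans_le hcand)
    box := fun x (hx : v.r .lo + x < v.r .hi + c) => by
      obtain hlt | hge := lt_or_ge (v.r .lo + x) (v.r .hi)
      · exact hv.box x hlt
      · have h := heq (v.r .lo + x - v.r .hi) (by omega)
        rwa [Nat.add_sub_cancel' hge,
          show v.r .hi - v.r .lo + (v.r .lo + x - v.r .hi) = x by omega] at h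
    lo_le := hv.lo_le
    pos_le := hv.pos_le
    cand_le := hcand
    reported := hv.reported
    status := .inr ⟨hm.alive, hbound, hm.step, hm.lo, hm.not_occurs, hm.foundAt⟩ }

theorem Examine.reject (hv : Examine α v) (hm : Matching α v) {c x : ℕ} (hx : x < I.m)
    (hne : I.text (v.r .lo + x) ≠ I.pattern x) :
    Examine α (((v.set .tmp c).set .bound 0).set .alive 0) :=
  { hv.toSearching.congr with
    lo_le := hv.lo_le
    pos_le := hv.pos_le
    cand_le := hv.cand_le
    reported := hv.reported
    status := .inl ⟨rfl, rfl, fun y hy (hlt : y < v.r .cand + v.r .step) => by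
      rw [hm.step] at hlt
      obtain hy' | hy' := lt_or_ge y (v.r .cand)
      · exact hm.not_occurs y hy hy'
      · exact Anchor.not_occurs_of_foundAt hm.foundAt (fun h => hne (hm.lo ▸ h x hx)) hy' hlt,
      .inl hm.step.ge⟩ }

theorem Examine.run_searchCompare (hv : Examine α v) (hlt : v.r .hi < v.r .bound) :
    Examine α (searchCompare.run I.inp v) ∧ (searchCompare.run I.inp v).r .pos = v.r .pos ∧
      ((searchCompare.run I.inp v).r .hi = v.r .hi + min π.q (v.r .bound - v.r .hi) ∧
        (searchCompare.run I.inp v).r .bound = v.r .bound ∨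
      (searchCompare.run I.inp v).r .hi = v.r .hi ∧ (searchCompare.run I.inp v).r .bound = 0) := by
  have hm := hv.matching hlt
  set c := min π.q (v.r .bound - v.r .hi)
  have hc : c ≤ v.r .bound - v.r .hi := min_le_right _ _
  have hblock : searchBlock.run I.inp v = v.set .tmp c := hv.toChosen.run_searchBlock
  have hck : c ≤ I.k := (min_le_left _ _).trans π.q_le_k
  have hparams : Params I (v.set .tmp c) := hv.toParams.congr
  have heq_iff := blockCode_eq_iff I.text_lt I.pattern_lt (v.r .hi) (v.r .hi - v.r .lo) c
  have htxt := val_window_txt hparams (p := Var.hi) (c := Var.tmp) (by simpa using hck)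
  have hpat := val_window_pat hparams (p := Var.hi - Var.lo) (c := Var.tmp) (by simpa using hck)
  by_cases heq : ∀ x < c, I.text (v.r .hi + x) = I.pattern (v.r .hi - v.r .lo + x)
  · have hrun : searchCompare.run I.inp v = (v.set .tmp c).set .hi (v.r .hi + c) := by
      have := heq_iff.2 heq
      simp [searchCompare, hblock, htxt, hpat, this]
    rw [hrun]
    exact ⟨hv.extend hm (by omega) heq, rfl, .inl ⟨rfl, rfl⟩⟩
  · have hrun : searchCompare.run I.inp v = ((v.set .tmp c).set .bound 0).set .alive 0 := by
      have := mt heq_iff.1 heq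
      simp [searchCompare, hblock, htxt, hpat, this]
    rw [hrun]
    push Not at heq
    obtain ⟨x, hx, hne⟩ := heq
    have := hv.lo_le_hi
    have := hm.bound
    have := hm.lo
    refine ⟨hv.reject hm (x := v.r .hi - v.r .lo + x) (by omega) ?_, rfl, .inr ⟨rfl, rfl⟩⟩
    rwa [show v.r .lo + (v.r .hi - v.r .lo + x) = v.r .hi + x by omega]

theorem Examine.safe_searchCompare (hv : Examine α v) (hlt : v.r .hi < v.r .bound) :
    searchCompare.Safe I.inp I.space v := by
  have hm := hv.matching hlt
  have hbound := hm.bound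
  have hcand := hv.cand_le
  have hlo := hv.lo_le_hi
  have hn := I.n_lt
  set c := min π.q (v.r .bound - v.r .hi)
  have hc : c ≤ v.r .bound - v.r .hi := min_le_right _ _
  have hblock : searchBlock.run I.inp v = v.set .tmp c := hv.toChosen.run_searchBlock
  have hck : c ≤ I.k := (min_le_left _ _).trans π.q_le_k
  have hparams : Params I (v.set .tmp c) := hv.toParams.congr
  have hdiv : ∀ p ≤ v.r .hi, p / I.k + 1 < 2 ^ w := fun p hp =>
    I.div_add_one_lt (by omega) (.inl (by omega))
  have htxt : (window .txt Var.hi Var.tmp).Safe I.inp I.space (v.set .tmp c) :=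
    safe_window .txt (fun _ => Iff.rfl) hparams trivial trivial (by simpa using hck)
      (by simpa using hdiv _ le_rfl)
  have hpat : (window .pat (Var.hi - Var.lo) Var.tmp).Safe I.inp I.space (v.set .tmp c) :=
    safe_window .pat (fun _ => Iff.rfl) hparams (by simpa using hlo) trivial (by simpa using hck)
      (by simpa using hdiv _ (Nat.sub_le _ _))
  have hadd : v.r .hi + c < 2 ^ w := by omega
  have hsafe : searchBlock.Safe I.inp I.space v := by simp [searchBlock, hlt.le]
  simp [searchCompare, hblock, hsafe, htxt, hpat, hadd]

theorem Plan.rounds_lt_of_add_le (π : Plan I) {x y : ℕ} (hxy : x + π.q ≤ y)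
    (hy : y ≤ I.n - I.m) : π.rounds y < π.rounds x := by
  have hdiv : (I.n - I.m - x) / π.q = (I.n - I.m - x - π.q) / π.q + 1 :=
    Nat.div_eq_sub_div π.q_pos (by omega)
  have hle : (I.n - I.m - y) / π.q ≤ (I.n - I.m - x - π.q) / π.q :=
    Nat.div_le_div_right (by omega)
  have hocc : I.occCount y ≤ I.occCount x := I.occCount_antitone (by omega)
  simp only [Plan.rounds]
  omega

theorem Plan.rounds_succ_lt (π : Plan I) {x s : ℕ} (hs : I.Occurs s) (hxs : x ≤ s) :
    π.rounds (s + 1) < π.rounds x := by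
  have hle : (I.n - I.m - (s + 1)) / π.q ≤ (I.n - I.m - x) / π.q :=
    Nat.div_le_div_right (by omega)
  have hocc : I.occCount (s + 1) < I.occCount x :=
    (I.occCount_succ_lt hs).trans_le (I.occCount_antitone hxs)
  simp only [Plan.rounds]
  omega

theorem Candidate.advancing_of_rejected (hv : Candidate α v) (h : Rejected π v) :
    Advancing α (v.r .pos) (v.set .alive 0) :=
  { hv.toSearching.congr with
    lo_le := hv.lo_le
    cand_le := hv.cand_le
    reported := hv.reported.mono (hv.pos_le.trans (Nat.le_add_right _ _)) h.not_occurs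
    progress := fun hle => π.rounds_lt_of_add_le
      (Nat.add_le_add hv.pos_le (h.progress.resolve_right (not_lt.2 hle))) hle }

theorem Matching.occurs (h : Matching α v) (hv : Candidate α v) (hle : v.r .bound ≤ v.r .hi) :
    I.Occurs (v.r .cand) :=
  ⟨hv.cand_le, fun j hj => h.lo ▸ hv.box j (by have := h.bound; have := h.lo; omega)⟩

theorem Candidate.advancing_of_matching (hv : Candidate α v) (h : Matching α v)
    (hle : v.r .bound ≤ v.r .hi) :
    Advancing α (v.r .pos) ((v.report (v.r .cand)).set .step 1) :=
  { hv.toSearching.congr with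
    lo_le := hv.lo_le
    cand_le := hv.cand_le
    reported := (hv.reported.mono hv.pos_le h.not_occurs).snoc (h.occurs hv hle)
    progress := fun _ => π.rounds_succ_lt (h.occurs hv hle) hv.pos_le }

theorem Examine.run_searchReport (hv : Examine α v) (hle : v.r .bound ≤ v.r .hi) :
    Advancing α (v.r .pos) (searchReport.run I.inp v) ∧
      (searchReport.run I.inp v).r .hi = v.r .hi := by
  obtain h | h := hv.status
  · have hrun : searchReport.run I.inp v = v.set .alive 0 := by simp [searchReport, h.alive]
    rw [hrun]
    exact ⟨hv.advancing_of_rejected h, rfl⟩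
  · have hrun : searchReport.run I.inp v = (v.report (v.r .cand)).set .step 1 := by
      simp [searchReport, h.alive]
    rw [hrun]
    exact ⟨hv.advancing_of_matching h hle, rfl⟩

theorem Advancing.run_searchAdvance {x : ℕ} (hv : Advancing α x v) :
    SearchInv α (searchAdvance.run I.inp v) ∧
      π.searchTime (searchAdvance.run I.inp v) + 300 ≤
        300 * π.rounds x + 100 * ((I.n - v.r .hi) / π.q) := by
  have hcand := hv.cand_le
  by_cases hlt : I.n - I.m - v.r .cand < v.r .step
  · have hrun : searchAdvance.run I.inp v = v.set .done 1 := by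
      simp [searchAdvance, hv.last, hlt]
    rw [hrun]
    have hpos : 1 ≤ π.rounds x := Nat.le_add_left _ _
    exact ⟨.inr ⟨rfl, hv.one, hv.reported.of_sub_lt (by omega)⟩,
      by simp [Plan.searchTime]; omega⟩
  · have hrun : searchAdvance.run I.inp v = v.set .pos (v.r .cand + v.r .step) := by
      simp [searchAdvance, hv.last, hlt]
    rw [hrun]
    have := hv.progress (by omega)
    exact ⟨.inl { hv.toSearching.congr with
      lo_le := hv.lo_le.trans (Nat.le_add_right _ _)
      pos_le := by simpa using by omega
      reported := hv.reported }, by simp [Plan.searchTime, hv.done]; omega⟩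

theorem Advancing.safe_searchAdvance {x : ℕ} (hv : Advancing α x v) :
    searchAdvance.Safe I.inp I.space v := by
  have := hv.cand_le
  have := I.n_lt
  by_cases hlt : I.n - I.m - v.r .cand < v.r .step
  · simpa [searchAdvance, hv.last, hlt, I.w_ne_zero] using by omega
  · simpa [searchAdvance, hv.last, hlt] using by omega

theorem Examine.wp_compareLoop (hv : Examine α v) (N : ℕ) :
    WP I.inp I.space (whileLt .hi .bound searchCompare.compile)
      (fun v' N' => (Examine α v' ∧ v'.r .pos = v.r .pos ∧ v'.r .bound ≤ v'.r .hi) ∧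
        N + 100 * ((I.n - v'.r .hi) / π.q) ≤ N') v
      (N + 100 * ((I.n - v.r .hi) / π.q) + 101) := by
  let f (u : View) := 100 * ((I.n - u.r .hi) / π.q) + 100 * min 1 (u.r .bound - u.r .hi)
  have hloop := WP.whileLt (inp := I.inp) (S := I.space) (x := .hi) (y := .bound)
    (p := searchCompare.compile) (J := fun u => Examine α u ∧ u.r .pos = v.r .pos) (N := N)
    f (fun u N' ⟨hu, hpos⟩ hlt => ?_) ⟨hv, rfl⟩
  · exact (hloop.mono_budget (by simp only [f]; omega)).mono
      fun _ _ ⟨⟨⟨hu, hpos⟩, hle⟩, hN⟩ => ⟨⟨hu, hpos, hle⟩, by simp only [f] at hN; omega⟩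
  · obtain ⟨hext, hpos', hprogress⟩ := hu.run_searchCompare hlt
    have hf : f (searchCompare.run I.inp u) + 100 ≤ f u := by
      have hbound := (hu.matching hlt).bound
      have hcand := hu.cand_le
      simp only [f]
      obtain ⟨hhi, hbound'⟩ | ⟨hhi, hbound'⟩ := hprogress
      · rw [hhi, hbound']
        obtain hq | hq := le_total π.q (u.r .bound - u.r .hi)
        · rw [min_eq_left hq, Nat.div_eq_sub_div π.q_pos (by omega : π.q ≤ I.n - u.r .hi),
            Nat.sub_sub]
          omega
        · have : (I.n - u.r .bound) / π.q ≤ (I.n - u.r .hi) / π.q :=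
            Nat.div_le_div_right (by omega)
          rw [min_eq_right hq, Nat.add_sub_cancel' hlt.le]
          omega
      · rw [hhi, hbound']
        omega
    exact ⟨f (searchCompare.run I.inp u) + 99, by omega, .cmd _ 99 (by decide) (add_assoc ..).le
      (hu.safe_searchCompare hlt) ⟨⟨hext, hpos'.trans hpos⟩, le_rfl⟩⟩

theorem RoundInv.wp_searchRound (hv : RoundInv α v) (N : ℕ) :
    WP I.inp I.space searchRound (fun v' N' => SearchInv α v' ∧ N + π.searchTime v' ≤ N') v
      (N + 300 * π.rounds (v.r .pos) + 100 * ((I.n - v.r .hi) / π.q) - 1) := by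
  have hrounds : 1 ≤ π.rounds (v.r .pos) := Nat.le_add_left _ _
  obtain ⟨hfound, hpos, hhi⟩ := hv.run_searchFind
  obtain ⟨hexam, hpos', hhi'⟩ := hfound.run_searchBegin
  set u := searchBegin.run I.inp (searchFind.run I.inp v)
  rw [hpos] at hpos'
  rw [hhi] at hhi'
  have hblocks : (I.n - u.r .hi) / π.q ≤ (I.n - v.r .hi) / π.q :=
    Nat.div_le_div_right (by omega)
  let M := N + 300 * π.rounds (v.r .pos) - 300
  refine .seq (.seq (.cmd (M + 17 + 100 * ((I.n - v.r .hi) / π.q) + 140) 48 (by decide)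
    (by simp only [M]; omega) hv.safe_searchFind ?_))
  refine .cmd (M + 17 + 100 * ((I.n - v.r .hi) / π.q) + 101) 39 (by decide) le_rfl
    hfound.safe_searchBegin ?_
  refine .seq (((hexam.wp_compareLoop (M + 17)).mono_budget (by omega)).mono ?_)
  rintro u' N' ⟨⟨hu', hpos'', hle⟩, hN⟩
  obtain ⟨hadv, hhi''⟩ := hu'.run_searchReport hle
  obtain ⟨hinv, htime⟩ := hadv.run_searchAdvance
  refine .seq (.cmd (N' - 7) 7 (by decide) (by omega) ?_ ?_)
  · by_cases halive : u'.r .alive = 1 <;> simp [searchReport, halive, I.w_ne_zero]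
  · refine .cmd (N' - 16) 9 (by decide) (by omega) hadv.safe_searchAdvance ⟨hinv, ?_⟩
    rw [hpos'', hpos', hhi''] at htime
    simp only [M] at hN
    omega

theorem Plan.searchTime_le (π : Plan I) (v : View) :
    π.searchTime v ≤ 300 * π.rounds 0 + 100 * (I.n / π.q) := by
  have hocc : I.occCount (v.r .pos) ≤ I.occCount 0 := I.occCount_antitone (Nat.zero_le _)
  refine Nat.add_le_add ?_ (Nat.mul_le_mul_left _ (Nat.div_le_div_right (Nat.sub_le _ _)))
  calc (1 - v.r .done) * (300 * π.rounds (v.r .pos)) ≤ 1 * (300 * π.rounds (v.r .pos)) :=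
        Nat.mul_le_mul_right _ (Nat.sub_le _ _)
    _ ≤ 300 * π.rounds 0 := by
        rw [one_mul, Plan.rounds, Plan.rounds]
        gcongr
        exact Nat.zero_le _

theorem triple_searchPhase : Triple I (fun v => HasShiftTable α v ∧ v.out = []) searchPhase
    (14 + (300 * π.rounds 0 + 100 * (I.n / π.q) + 1)) (fun v => I.Reported (I.n + 1) v.out) := by
  have hinit : Triple I (fun v => HasShiftTable α v ∧ v.out = []) searchInit.compile 14
      (SearchInv α) := by
    refine .cmd (by decide) (fun v ⟨hv, _⟩ => ?_) fun v ⟨hv, hout⟩ => .inl (hv.run_searchInit hout)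
    simp [searchInit, hv.m, hv.n, I.m_le, I.w_ne_zero]
  refine hinit.seq ((Triple.whileLt π.searchTime (fun v N hv hlt => ?_)
    fun v _ => π.searchTime_le v).mono fun v ⟨hv, _⟩ => ?_)
  · have hv := hv.resolve_right fun h => by omega
    have hrounds : 1 ≤ π.rounds (v.r .pos) := Nat.le_add_left _ _
    have htime : π.searchTime v =
        300 * π.rounds (v.r .pos) + 100 * ((I.n - v.r .hi) / π.q) := by
      simp [Plan.searchTime, hv.done]
    exact ⟨π.searchTime v - 1, by omega, (hv.wp_searchRound N).mono_budget (by omega)⟩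
  · obtain hv | hv := hv
    · have := hv.done
      have := hv.one
      omega
    · exact hv.2.2

end Search

/-! ### The algorithm -/

/-- The string matching algorithm. -/
def matchProgram : Program :=
  .seq choosePhase (.seq prefixPhase (.seq anchorPhase (.seq tablePhase searchPhase)))

section Match

variable {w : ℕ} {I : Problem w}

theorem Triple.exists {α : Type*} {P : α → View → Prop} {Q : View → Prop} {p : Program} {c : ℕ}
    (h : ∀ a, Triple I (P a) p c Q) : Triple I (fun v => ∃ a, P a v) p c Q :=
  fun v N ⟨a, hP⟩ => h a v N hP

theorem Triple.mono_cost {P Q : View → Prop} {p : Program} {c c' : ℕ} (h : Triple I P p c Q)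
    (hc : c ≤ c') : Triple I P p c' Q :=
  fun v N hP => (h v N hP).mono_budget (Nat.add_le_add_left hc N)

theorem triple_matchProgram {B : ℕ} (hB : ∀ π : Plan I, I.n / π.q ≤ B) :
    Triple I (fun v => Params I v ∧ v.out = []) matchProgram
      (400 * B + 300 * I.occCount 0 + 190 * I.m + 93 * I.t + 462)
      (fun v => I.Reported (I.n + 1) v.out) := by
  have hsearch (π : Plan I) (α : Anchor π) :
      Triple I (fun v => HasShiftTable α v ∧ v.out = []) searchPhase
        (400 * B + 300 * I.occCount 0 + 315) (fun v => I.Reported (I.n + 1) v.out) := by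
    have hq := hB π
    have hrounds : (I.n - I.m - 0) / π.q ≤ I.n / π.q := Nat.div_le_div_right (by omega)
    refine triple_searchPhase.mono_cost ?_
    rw [Plan.rounds]
    omega
  have htable (π : Plan I) := Triple.exists fun α : Anchor π => triple_tablePhase.seq (hsearch π α)
  have hplan := Triple.exists fun π : Plan I =>
    triple_prefixPhase.seq (triple_anchorPhase.seq (htable π))
  exact (triple_choosePhase.seq hplan).mono_cost (by omega)

theorem exists_exec_matchProgram {B : ℕ} (hB : ∀ π : Plan I, I.n / π.q ≤ B) {s : State w}
    (hs : Params I s.view) (hout : s.out = []) :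
    ∃ T s', Exec I.inp I.space matchProgram s T s' ∧
      I.Reported (I.n + 1) (s'.out.map BitVec.toNat) ∧
      T ≤ 400 * B + 300 * I.occCount 0 + 190 * I.m + 93 * I.t + 462 := by
  obtain ⟨T, s', n, hexec, hT, hrep, -⟩ :=
    triple_matchProgram hB s.view 0 ⟨hs, by simp [State.view, hout]⟩ s rfl
  exact ⟨T, s', hexec, hrep, by omega⟩

end Match

/-! ### The running time -/

theorem charBits_mul_log_two_le {σ : ℕ} (hσ : 2 ≤ σ) :
    charBits σ * Real.log 2 ≤ 2 * Real.log σ := by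
  have hlt : 2 ^ (charBits σ - 1) < σ := Nat.pow_pred_clog_lt_self one_lt_two (by omega)
  have hpred : ((charBits σ - 1 : ℕ) : ℝ) * Real.log 2 ≤ Real.log σ := by
    rw [← Real.log_pow]
    exact Real.log_le_log (by positivity) (by exact_mod_cast hlt.le)
  have hlog : Real.log 2 ≤ Real.log σ := Real.log_le_log two_pos (by exact_mod_cast hσ)
  have hpos : 1 ≤ charBits σ := Nat.clog_pos one_lt_two hσ
  rw [Nat.cast_sub hpos, Nat.cast_one] at hpred
  linarith

theorem logb_le_of_lt_two_pow {σ t c : ℕ} (hσ : 2 ≤ σ) (ht : 0 < t)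
    (h : t < 2 ^ (c * charBits σ)) : Real.logb σ t ≤ 2 * c := by
  rw [Real.logb, div_le_iff₀ (Real.log_pos (by exact_mod_cast hσ))]
  calc Real.log t ≤ Real.log (2 ^ (c * charBits σ)) :=
        Real.log_le_log (by exact_mod_cast ht) (by exact_mod_cast h.le)
    _ = c * (charBits σ * Real.log 2) := by rw [Real.log_pow]; push_cast; ring
    _ ≤ c * (2 * Real.log σ) := by gcongr ?_ * ?_; exact charBits_mul_log_two_le hσ
    _ = 2 * c * Real.log σ := by ring

section RunningTime

variable {w σ : ℕ} {I : Problem w} {a : ℝ}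

theorem Plan.q_large_or_n_small (π : Plan I) :
    I.k ≤ 6 * π.q ∨ I.t < 2 ^ (6 * π.q * I.b) ∨ I.n ≤ 4 * I.m + 4 * I.t + 3 := by
  have hpow {c d : ℕ} (h : I.t < 2 ^ (c * I.b)) (hcd : c ≤ d) : I.t < 2 ^ (d * I.b) :=
    h.trans_le (Nat.pow_le_pow_right two_pos (Nat.mul_le_mul_right _ hcd))
  obtain ⟨q, flag, h⟩ := π
  cases h with
  | table pos _ _ maximal =>
    exact maximal.imp (fun h => by dsimp only; omega) fun h => .inl (hpow h (by dsimp only; omega))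
  | scan h =>
    obtain h | h | h | h := h
    · exact .inr (.inr (by omega))
    · exact .inr (.inr (by omega))
    · exact .inl (by dsimp only; omega)
    · exact .inr (.inl (hpow h (by norm_num)))

theorem Plan.logb_le (π : Plan I) (hσ : 2 ≤ σ) (hb : I.b = charBits σ)
    (ha : Real.logb σ I.n ≤ a * I.k) (hn : 4 * I.m + 4 * I.t + 3 < I.n) :
    Real.logb σ I.t ≤ (12 + 6 * |a|) * π.q := by
  have htn : Real.logb σ I.t ≤ |a| * I.k :=
    calc Real.logb σ I.t ≤ Real.logb σ I.n :=
          Real.logb_le_logb_of_le (by exact_mod_cast hσ)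
            (by exact_mod_cast zero_lt_two.trans_le I.t_ge) (by exact_mod_cast (by omega))
      _ ≤ a * I.k := ha
      _ ≤ |a| * I.k := by gcongr; exact le_abs_self a
  have haq : 0 ≤ |a| * π.q := by positivity
  obtain hk | ht | hn' := π.q_large_or_n_small
  · calc Real.logb σ I.t ≤ |a| * I.k := htn
      _ ≤ |a| * (6 * π.q) := by gcongr; exact_mod_cast hk
      _ ≤ (12 + 6 * |a|) * π.q := by linarith [Nat.cast_nonneg (α := ℝ) π.q]
  · rw [hb] at ht
    have hlogb := logb_le_of_lt_two_pow hσ (zero_lt_two.trans_le I.t_ge) ht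
    push_cast at hlogb
    linarith
  · omega

theorem Plan.n_div_q_le (π : Plan I) (hσ : 2 ≤ σ) (hb : I.b = charBits σ)
    (ha : Real.logb σ I.n ≤ a * I.k) :
    ((I.n / π.q : ℕ) : ℝ) ≤
      (12 + 6 * |a|) * (I.n / Real.logb σ I.t) + (4 * I.m + 4 * I.t + 3) := by
  have hlogb : 0 < Real.logb σ I.t :=
    Real.logb_pos (by exact_mod_cast hσ) (by exact_mod_cast I.t_ge)
  obtain hn | hn := le_or_gt I.n (4 * I.m + 4 * I.t + 3)
  · refine le_add_of_nonneg_of_le (by positivity) ?_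
    exact_mod_cast (Nat.div_le_self I.n π.q).trans hn
  · refine le_add_of_le_of_nonneg (Nat.cast_div_le.trans ?_) (by positivity)
    rw [← mul_div_assoc, div_le_div_iff₀ (by exact_mod_cast π.q_pos) hlogb]
    calc (I.n : ℝ) * Real.logb σ I.t ≤ I.n * ((12 + 6 * |a|) * π.q) := by
          gcongr
          exact π.logb_le hσ hb ha hn
      _ = (12 + 6 * |a|) * I.n * π.q := by ring

theorem exists_exec_matchProgram_of_logb_le (hσ : 2 ≤ σ) (hb : I.b = charBits σ)
    (ha : Real.logb σ I.n ≤ a * I.k) {s : State w} (hs : Params I s.view) (hout : s.out = []) :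
    ∃ T s', Exec I.inp I.space matchProgram s T s' ∧
      I.Reported (I.n + 1) (s'.out.map BitVec.toNat) ∧
      (T : ℝ) ≤ (2400 * |a| + 4800) * (I.n / Real.logb σ I.t + I.t + I.m + I.occCount 0) := by
  have hlogb : 0 < Real.logb σ I.t :=
    Real.logb_pos (by exact_mod_cast hσ) (by exact_mod_cast I.t_ge)
  have hD : 0 ≤ I.n / Real.logb σ I.t := by positivity
  set D := I.n / Real.logb σ I.t
  set B := (12 + 6 * |a|) * D + (4 * I.m + 4 * I.t + 3)
  obtain ⟨T, s', hexec, hrep, hT⟩ := exists_exec_matchProgram (B := ⌊B⌋₊)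
    (fun π => Nat.le_floor (π.n_div_q_le hσ hb ha)) hs hout
  refine ⟨T, s', hexec, hrep, ?_⟩
  have ht : (2 : ℝ) ≤ I.t := by exact_mod_cast I.t_ge
  have hrest : 0 ≤ |a| * (I.t + I.m + I.occCount 0) := by positivity
  calc (T : ℝ) ≤ 400 * ⌊B⌋₊ + 300 * I.occCount 0 + 190 * I.m + 93 * I.t + 462 := by
        exact_mod_cast hT
    _ ≤ 400 * B + 300 * I.occCount 0 + 190 * I.m + 93 * I.t + 462 := by
        gcongr
        exact Nat.floor_le (by positivity)
    _ ≤ (2400 * |a| + 4800) * (D + I.t + I.m + I.occCount 0) := by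
        simp only [B]
        linarith [Nat.cast_nonneg (α := ℝ) I.m, Nat.cast_nonneg (α := ℝ) (I.occCount 0)]

end RunningTime

/-! ### Packed strings -/

section Packed

variable {w σ k t S : ℕ} {P Q : List (Fin σ)}

theorem charCode_of_lt (A : List (Fin σ)) {i : ℕ} (h : i < A.length) : charCode A i = A[i] := by
  simp [charCode, h]

theorem charCode_lt (hσ : 2 ≤ σ) (A : List (Fin σ)) (i : ℕ) : charCode A i < 2 ^ charBits σ := by
  refine lt_of_lt_of_le ?_ (Nat.le_pow_clog one_lt_two σ)
  obtain h | h := lt_or_ge i A.length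
  · rw [charCode_of_lt A h]
    exact A[i].isLt
  · simpa [charCode, h] using two_pos.trans_le hσ

theorem toNat_packedWord (hσ : 2 ≤ σ) (hk : k * charBits σ ≤ w) (A : List (Fin σ)) (x : ℕ) :
    (packedWord w k A x).toNat = blockCode (charBits σ) (charCode A) (x * k) k := by
  rw [packedWord, BitVec.toNat_ofNat]
  exact Nat.mod_eq_of_lt ((blockCode_lt (charCode_lt hσ A) (x * k) k).trans_le
    (Nat.pow_le_pow_right two_pos hk))

/-- The matching problem posed by the packed representations of two strings. -/
def packedProblem (hσ : 2 ≤ σ) (hk : 1 ≤ k) (hkw : k * charBits σ ≤ w) (hPQ : P.length ≤ Q.length)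
    (hQ : Q.length < 2 ^ w) (ht : 2 ≤ t) (htw : t < 2 ^ w) (hS : t + P.length ≤ S) :
    Problem w where
  inp := packedInput w k P Q
  space := S
  m := P.length
  n := Q.length
  t := t
  b := charBits σ
  k := k
  text := charCode Q
  pattern := charCode P
  b_pos := Nat.clog_pos one_lt_two hσ
  k_pos := hk
  fits := hkw
  m_le := hPQ
  n_lt := hQ
  t_ge := ht
  t_lt := htw
  space_ge := hS
  text_lt := charCode_lt hσ Q
  pattern_lt := charCode_lt hσ P
  inp_txt := toNat_packedWord hσ hkw Q
  inp_pat := toNat_packedWord hσ hkw P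

theorem params_initState (I : Problem w) (hm : I.m = P.length) (hn : I.n = Q.length)
    (hb : I.b = charBits σ) (mem : BitVec w → BitVec w) :
    Params I (initState w I.k I.t P Q mem).view := by
  have hm_lt := I.m_le.trans_lt I.n_lt
  have hn_lt := I.n_lt
  have hb_lt : I.b < 2 ^ w := by simpa using I.mul_b_lt I.k_pos
  have hk_lt : I.k < 2 ^ w :=
    (Nat.le_mul_of_pos_right I.k I.b_pos).trans_lt (I.mul_b_lt le_rfl)
  rw [hm] at hm_lt
  rw [hn] at hn_lt
  rw [hb] at hb_lt
  constructor <;> simp only [State.view, initState, hm, hn, hb] <;>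
    exact Nat.mod_eq_of_lt (by first | assumption | exact I.t_lt)

theorem mem_occurrences_iff (P Q : List (Fin σ)) (i : ℕ) : i ∈ occurrences P Q ↔
    i + P.length ≤ Q.length ∧ MatchAt (charCode Q) (charCode P) P.length i := by
  simp only [occurrences, Finset.mem_filter, Finset.mem_range, MatchAt, List.prefix_iff_getElem,
    List.length_drop, List.getElem_drop]
  constructor
  · rintro ⟨hi, hlen, h⟩
    refine ⟨by omega, fun j hj => ?_⟩
    rw [charCode_of_lt Q (by omega), charCode_of_lt P hj, h j hj]
  · rintro ⟨hlen, h⟩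
    refine ⟨by omega, by omega, fun j hj => ?_⟩
    have hcode := h j hj
    rw [charCode_of_lt Q (by omega), charCode_of_lt P hj, Fin.val_inj] at hcode
    exact hcode.symm

theorem Problem.Reported.reportsOccurrences {I : Problem w}
    (hI : ∀ i, i ∈ occurrences P Q ↔ I.Occurs i) {out : List (BitVec w)}
    (h : I.Reported (I.n + 1) (out.map BitVec.toNat)) : ReportsOccurrences P Q out := by
  refine ⟨h.1.of_map _, fun i => ?_⟩
  rw [h.2, hI, and_iff_left_iff_imp]
  exact fun hi => Nat.lt_succ_of_le (le_of_add_le_left hi.1)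

theorem Problem.occCount_zero {I : Problem w} (hI : ∀ i, i ∈ occurrences P Q ↔ I.Occurs i) :
    I.occCount 0 = (occurrences P Q).card := by
  rw [← Set.ncard_coe_finset, Problem.occCount]
  congr 1
  ext i
  simp [hI]

end Packed

end PackedMatching

/-- The number `k` of characters per word is `Θ(log n / log σ)`: the lower bound is
`log_σ n ≤ a * k` for an arbitrary constant `a`, on which only the constant `C` may depend; the
upper bound is that `k` characters fit into a word. -/
theorem mainTheorem2 :
    ∃ prog : PackedMatching.Program, ∀ a : ℝ, ∃ C : ℕ,
      ∀ (w σ k t : ℕ) (P Q : List (Fin σ)) (mem : BitVec w → BitVec w),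
        2 ≤ σ → 1 ≤ k → k * PackedMatching.charBits σ ≤ w →
        Real.logb σ Q.length ≤ a * k →
        P.length ≤ Q.length → Q.length < 2 ^ w →
        2 ≤ t → t < 2 ^ w →
        ∃ (T : ℕ) (s : PackedMatching.State w),
          PackedMatching.Exec (PackedMatching.packedInput w k P Q) (C * (t + P.length)) prog
            (PackedMatching.initState w k t P Q mem) T s ∧
          PackedMatching.ReportsOccurrences P Q s.out ∧
          (T : ℝ) ≤ C * (Q.length / Real.logb σ t + t + P.length +
            (PackedMatching.occurrences P Q).card) := by
  open PackedMatching in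
  refine ⟨matchProgram, fun a => ⟨⌈2400 * |a|⌉₊ + 4800, ?_⟩⟩
  intro w σ k t P Q mem hσ hk hkw ha hPQ hQ ht htw
  have hspace : t + P.length ≤ (⌈2400 * |a|⌉₊ + 4800) * (t + P.length) :=
    Nat.le_mul_of_pos_left _ (by omega)
  let I := packedProblem hσ hk hkw hPQ hQ ht htw hspace
  have hI : ∀ i, i ∈ occurrences P Q ↔ I.Occurs i := mem_occurrences_iff P Q
  obtain ⟨T, s, hexec, hrep, hT⟩ := exists_exec_matchProgram_of_logb_le (I := I) hσ rfl ha
    (params_initState I rfl rfl rfl mem) rfl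
  rw [Problem.occCount_zero hI] at hT
  have hlogb : 0 < Real.logb σ t := Real.logb_pos (by exact_mod_cast hσ) (by exact_mod_cast ht)
  refine ⟨T, s, hexec, hrep.reportsOccurrences hI,
    hT.trans (mul_le_mul_of_nonneg_right ?_ (by positivity))⟩
  push_cast
  gcongr
  exact Nat.le_ceil _
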